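/- For $n\ge 0$ and a lower triangular matrix $H=[h_{k,j}]\in\mathbb R^{n\times n}$ (set $h_{k,j}=0$ for $j>k$), the method defined by $H$ is $$y_{k+1}=y_k-\sum_{j=0}^{k}h_{k+1,j+1}\,(y_j-Ty_j),\qquad k=0,\dots,n-1 .$$ Write $N=n+1$. Let $\mathcal H_\star(N-1)$ be the set of lower triangular $H\in\mathbb R^{(N-1)\times(N-1)}$ whose method satisfies $\|y_{N-1}-Ty_{N-1}\|^2\le 4\|y_0-y_\star\|^2/N^2$ for every nonexpansive operator $T$ on a real Hilbert space, every fixed point $y_\star$ of $T$ and every starting point $y_0$. For $m\ge 1$ put $$Q(m,j;H)=\sum_{j=j(1)\le i(1)<j(2)\le i(2)<\cdots<j(m)\le i(m)\le N-1}\ \prod_{r=1}^m h_{i(r),j(r)},$$ and define the H-certificates $$\lambda^\star_{N,j}(H)=N\sum_{m=1}^{N-1}(-1)^{m-1}Q(m,j;H)\quad(1\le j\le N-1),$$ $$\lambda^\star_{k,j}(H)=N\sum_{\ell=1}^{N-1}\sum_{m=1}^{N-1}(-1)^{\ell+m-1}\binom{\ell+m}{m}Q(\ell,j;H)\,Q(m,k;H)\quad(1\le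 j<k\le N-1).$$ A vertex of $\mathcal H_\star(N-1)$ is an $H\in\mathcal H_\star(N-1)$ for which the number of pairs $1\le j<k\le N$ with $\lambda^\star_{k,j}(H)=0$ is maximal among all elements of $\mathcal H_\star(N-1)$. $H$ is decomposable at $N'\in\{1,\dots,N-1\}$ if $\lambda^\star_{N,N'}(H)>0$, $\lambda^\star_{k,N'}(H)=0$ for $N'<k<N$, and $\lambda^\star_{k,j}(H)=0$ whenever $1\le j<N'<k\le N$. For an $(N'-1)\times(N'-1)$ matrix $H_1$ and an $(N-N'-1)\times(N-N'-1)$ matrix $H_2$, the gluing $H_1\bowtie H_2$ is the $(N-1)\times(N-1)$ lower triangular matrix with diagonal block $H_1$ in rows and columns $1,\dots,N'-1$, diagonal block $H_2$ in rows and columns $N'+1,\dots,N-1$, row $N'$ given by $h_{N',j}=-\frac{N-N'}{N}\sum_{k=j}^{N'-1}(H_1)_{k,j}$ for $j<N'$ and $h_{N',N'}=\frac{N'(N-N')}{N}$, zeros in rows $>N'$ and columns $<N'$, and $h_{N'+1,N'},\dots,h_{N-1,N'}$ determined by $Q(k,N';H_1\bowtie H_2)=\frac{N'(N-N'+1)}{N(k+1)}\binom{N-N'-1}{k-1}$,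 $k=1,\dots,N-N'$ (a linear system, solved by forward substitution). Let $H_{\text{Dual-OHM}}(N-1)$ have entries $-\frac{N-k}{(N-j)(N-j+1)}$ for $j<k$ and $\frac{N-k}{N-k+1}$ for $j=k$, and let $(H^{\mathsf A})_{k,j}=h_{N-j,N-k}$. RDO($p$), $p\ge1$, is the method whose H-matrix for the first $np$ iterations is, for every $n$, $H^{(n)}_{\text{RDO}(p)}$, where $H^{(0)}_{\text{RDO}(p)}$ is the empty matrix and $H^{(n)}_{\text{RDO}(p)}=H^{(n-1)}_{\text{RDO}(p)}\bowtie H_{\text{Dual-OHM}}(p-1)$. FSDM is the method whose H-matrix for the first $2^n-1$ iterations is, for every $n$, $H^{(n)}$, where $H^{(0)}$ is the empty matrix and $H^{(n)}=H^{(n-1)}\bowtie (H^{(n-1)})^{\mathsf A}$. **Corollary.** Let $T$ be a nonexpansive operator on a real Hilbert space with a fixed point $y_\star$, and let $y_0$ be any starting point. 1. If $H$ is a vertex of $\mathcal H_\star(N-1)$ and is decomposable at $N'\in\{1,\dots,N-1\}$, then its method satisfies $\|y_{N'-1}-Ty_{N'-1}\|^2\le \frac{4\|y_0-y_\star\|^2}{(N')^2}$.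 2. For every $p\ge 1$ and $k\ge 0$, RDO($p$) satisfies $\|y_{kp}-Ty_{kp}\|^2\le\frac{4\|y_0-y_\star\|^2}{(kp+1)^2}$. 3. For every $n\ge 0$, FSDM satisfies $\|y_{2^n-1}-Ty_{2^n-1}\|^2\le\frac{4\|y_0-y_\star\|^2}{(2^n)^2}$. -/

import Mathlib

namespace HMat

open Finset

/-- The entry `h_{i,j}` of an `n × n` matrix with indices `1 ≤ i, j ≤ n`, extended by `0`. -/
noncomputable def ent {n : ℕ} (H : Matrix (Fin n) (Fin n) ℝ) (i j : ℕ) : ℝ :=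
  if h : (1 ≤ i ∧ i ≤ n) ∧ (1 ≤ j ∧ j ≤ n) then
    H ⟨i - 1, by omega⟩ ⟨j - 1, by omega⟩
  else 0

/-- The `n × n` matrix with entries `h_{i,j} = f i j`, `1 ≤ i, j ≤ n`. -/
def ofEnt (n : ℕ) (f : ℕ → ℕ → ℝ) : Matrix (Fin n) (Fin n) ℝ :=
  Matrix.of fun i j => f (i + 1) (j + 1)

theorem ent_ofEnt {n : ℕ} (f : ℕ → ℕ → ℝ) {i j : ℕ} (hi : 1 ≤ i ∧ i ≤ n)
    (hj : 1 ≤ j ∧ j ≤ n) : ent (ofEnt n f) i j = f i j := by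
  unfold ent ofEnt
  rw [dif_pos ⟨hi, hj⟩]
  simp only [Matrix.of_apply]
  congr 1 <;> omega

theorem ent_eq_zero {n : ℕ} (H : Matrix (Fin n) (Fin n) ℝ) {i j : ℕ}
    (h : ¬ ((1 ≤ i ∧ i ≤ n) ∧ (1 ≤ j ∧ j ≤ n))) : ent H i j = 0 := dif_neg h

/-- The iterates of the fixed-step method with step sizes `h_{k,j}`:
`y_{k+1} = y_k - ∑_{j=0}^k h_{k+1,j+1} (y_j - T y_j)`. -/
noncomputable def iter {X : Type*} [AddCommGroup X] [Module ℝ X]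
    (h : ℕ → ℕ → ℝ) (T : X → X) (y₀ : X) : ℕ → X
  | 0 => y₀
  | k + 1 => iter h T y₀ k -
      ∑ j : Fin (k + 1), h (k + 1) (j + 1) • (iter h T y₀ j - T (iter h T y₀ j))

/-- `optimalSet n` is the set `𝓗⋆(n)`, where `n = N - 1`: the lower triangular `n × n` matrices
whose method satisfies `‖y_{N-1} - T y_{N-1}‖² ≤ 4 ‖y₀ - y⋆‖² / N²` for every nonexpansive `T` on a
Hilbert space with a fixed point `y⋆`, and every starting point `y₀`. -/
def optimalSet (n : ℕ) : Set (Matrix (Fin n) (Fin n) ℝ) :=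
  {H | (∀ i j : Fin n, i < j → H i j = 0) ∧
    ∀ (X : Type) [NormedAddCommGroup X] [InnerProductSpace ℝ X] [CompleteSpace X]
      (T : X → X), LipschitzWith 1 T → ∀ y₀ yStar : X, T yStar = yStar →
        ‖iter (ent H) T y₀ n - T (iter (ent H) T y₀ n)‖ ^ 2
          ≤ 4 * ‖y₀ - yStar‖ ^ 2 / ((n : ℝ) + 1) ^ 2}

/-- The Q-function `Q(m, j; H)`, `m ≥ 1`: the sum of `∏_{r=1}^m h_{i(r),j(r)}` over all
`j = j(1) ≤ i(1) < j(2) ≤ i(2) < ⋯ < j(m) ≤ i(m) ≤ n`, organised by the first factor. -/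
noncomputable def Q {n : ℕ} (H : Matrix (Fin n) (Fin n) ℝ) : ℕ → ℕ → ℝ
  | 0, _ => 0
  | 1, j => ∑ i ∈ Icc j n, ent H i j
  | m + 2, j => ∑ i ∈ Icc j n, ent H i j * ∑ j' ∈ Icc (i + 1) n, Q H (m + 1) j'

/-- The H-certificates `λ⋆_{k,j}(H)`, for `1 ≤ j < k ≤ N = n + 1`. -/
noncomputable def cert {n : ℕ} (H : Matrix (Fin n) (Fin n) ℝ) (k j : ℕ) : ℝ :=
  if k = n + 1 then
    ((n : ℝ) + 1) * ∑ m ∈ Icc 1 n, (-1 : ℝ) ^ (m - 1) * Q H m j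
  else
    ((n : ℝ) + 1) * ∑ l ∈ Icc 1 n, ∑ m ∈ Icc 1 n,
      (-1 : ℝ) ^ (l + m - 1) * ((l + m).choose m : ℝ) * Q H l j * Q H m k

/-- The index pairs `(k, j)`, `1 ≤ j < k ≤ N = n + 1`, at which the H-certificate vanishes. -/
def zeroCerts {n : ℕ} (H : Matrix (Fin n) (Fin n) ℝ) : Set (ℕ × ℕ) :=
  {q | 1 ≤ q.2 ∧ q.2 < q.1 ∧ q.1 ≤ n + 1 ∧ cert H q.1 q.2 = 0}

/-- A vertex of `𝓗⋆(n)`: an element lying in the zero sets of a maximal number of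
H-certificates (equivalently, with a minimal number of active certificates). -/
def IsVertex {n : ℕ} (H : Matrix (Fin n) (Fin n) ℝ) : Prop :=
  H ∈ optimalSet n ∧ ∀ H' ∈ optimalSet n, (zeroCerts H').ncard ≤ (zeroCerts H).ncard

/-- Decomposability of `H ∈ 𝓗⋆(n)`, `N = n + 1`, at `N' ∈ {1, …, N - 1}`. -/
def DecomposableAt {n : ℕ} (H : Matrix (Fin n) (Fin n) ℝ) (N' : ℕ) : Prop :=
  (0 < cert H (n + 1) N' ∧ ∀ k, N' + 1 ≤ k → k ≤ n → cert H k N' = 0) ∧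
  ∀ j k, 1 ≤ j → j + 1 ≤ N' → N' + 1 ≤ k → k ≤ n + 1 → cert H k j = 0

/-- For `N' = a + 1` and `N = a + b + 2`, the value
`N' (N - N' + 1) / (N (k + 1)) * binom (N - N' - 1) (k - 1)` prescribed for
`Q(k, N'; H₁ ⋈ H₂)`, `1 ≤ k ≤ N - N'`. -/
noncomputable def glueQ (a b k : ℕ) : ℝ :=
  ((a : ℝ) + 1) * ((b : ℝ) + 2) / (((a : ℝ) + b + 2) * ((k : ℝ) + 1)) * (b.choose (k - 1) : ℝ)

/-- The entries `h_{N'+s, N'}`, `0 ≤ s ≤ b`, of column `N' = a + 1` of the gluing of an `a × a`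
matrix with the `b × b` matrix `H₂` (`N = a + b + 2`). The entry with `s = 0` is
`N' (N - N') / N`. The others are determined by `Q(k, N') = glueQ a b k` for `1 ≤ k ≤ N - N'`,
and are computed by forward substitution: for `i = N' + s < N - 1`,
`h_{i,N'} = (Q(N-i, N') - ∑_{l=N'+1}^{i} (∑_{m=N'}^{l-1} h_{m,N'}) Q(N-i-1, l)) / Q(N-i-1, i+1)`
`- ∑_{m=N'}^{i-1} h_{m,N'}`, and for `i = N - 1`,
`h_{N-1,N'} = Q(1, N') - ∑_{m=N'}^{N-2} h_{m,N'}`; here `Q(m, N' + t) = Q(m, t; H₂)`. -/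
noncomputable def glueCol (a : ℕ) {b : ℕ} (H₂ : Matrix (Fin b) (Fin b) ℝ) : ℕ → ℝ
  | 0 => ((a : ℝ) + 1) * ((b : ℝ) + 1) / ((a : ℝ) + b + 2)
  | s + 1 =>
    if s + 1 = b then
      glueQ a b 1 - ∑ m : Fin (s + 1), glueCol a H₂ m
    else
      1 / Q H₂ (b - (s + 1)) (s + 2) *
        (glueQ a b (b - (s + 1) + 1) -
          ∑ t : Fin (s + 1), (∑ m : Fin (t + 1), glueCol a H₂ m) * Q H₂ (b - (s + 1)) (t + 1))
      - ∑ m : Fin (s + 1), glueCol a H₂ m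

/-- The gluing `H₁ ⋈ H₂` of an `a × a` and a `b × b` matrix, with `N' = a + 1`, `N = a + b + 2`:
an `(N-1) × (N-1)` matrix with diagonal blocks `H₁` (indices `1, …, N'-1`) and `H₂` (indices
`N'+1, …, N-1`), row `N'` with entries `h_{N',j} = -(N-N')/N * ∑_{k=j}^{N'-1} (H₁)_{k,j}` for
`j < N'`, column `N'` given by `glueCol`, and zeros elsewhere. -/
noncomputable def glue {a b : ℕ} (H₁ : Matrix (Fin a) (Fin a) ℝ) (H₂ : Matrix (Fin b) (Fin b) ℝ) :
    Matrix (Fin (a + b + 1)) (Fin (a + b + 1)) ℝ :=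
  ofEnt (a + b + 1) fun i j =>
    if i ≤ a then ent H₁ i j
    else if i = a + 1 ∧ j ≤ a then
      -(((b : ℝ) + 1) / ((a : ℝ) + b + 2)) * ∑ k ∈ Icc j a, ent H₁ k j
    else if j ≤ a then 0
    else if j = a + 1 then glueCol a H₂ (i - (a + 1))
    else ent H₂ (i - (a + 1)) (j - (a + 1))

/-- The H-dual: reflection along the anti-diagonal, `(H^A)_{k,j} = h_{N-j,N-k}`, `N = n + 1`. -/
def dual {n : ℕ} (H : Matrix (Fin n) (Fin n) ℝ) : Matrix (Fin n) (Fin n) ℝ :=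
  Matrix.of fun i j => H j.rev i.rev

/-- The Dual-OHM matrix of size `n = N - 1`: `-(N-k)/((N-j)(N-j+1))` for `j < k`,
`(N-k)/(N-k+1)` for `j = k`, and `0` for `j > k`. -/
noncomputable def dualOHM (n : ℕ) : Matrix (Fin n) (Fin n) ℝ :=
  ofEnt n fun k j =>
    if j < k then
      -(((n : ℝ) + 1 - k) / (((n : ℝ) + 1 - j) * ((n : ℝ) + 1 - j + 1)))
    else if j = k then ((n : ℝ) + 1 - k) / ((n : ℝ) + 1 - k + 1)
    else 0

/-- Transport of a square matrix along an equality of sizes. -/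
def recast {m n : ℕ} (h : n = m) (H : Matrix (Fin m) (Fin m) ℝ) : Matrix (Fin n) (Fin n) ℝ :=
  H.submatrix (Fin.cast h) (Fin.cast h)

theorem ent_recast {m n : ℕ} (h : n = m) (H : Matrix (Fin m) (Fin m) ℝ) (i j : ℕ) :
    ent (recast h H) i j = ent H i j := by
  subst h; rfl

/-- `H_{RDO(p)}^{(0)} = [ ]` and `H_{RDO(p)}^{(n+1)} = H_{RDO(p)}^{(n)} ⋈ H_{Dual-OHM}(p-1)`. -/
noncomputable def rdoMatrix (p : ℕ) (hp : 1 ≤ p) :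
    (n : ℕ) → Matrix (Fin (n * p)) (Fin (n * p)) ℝ
  | 0 => Matrix.of fun _ _ => 0
  | n + 1 => recast (show (n + 1) * p = n * p + (p - 1) + 1 by rw [Nat.succ_mul]; omega)
      (glue (rdoMatrix p hp n) (dualOHM (p - 1)))

/-- `H_{FSDM}(0) = [ ]` and `H_{FSDM}(2^{n+1}-1) = H_{FSDM}(2^n-1) ⋈ H_{FSDM}(2^n-1)^A`. -/
noncomputable def fsdmMatrix : (n : ℕ) → Matrix (Fin (2 ^ n - 1)) (Fin (2 ^ n - 1)) ℝ
  | 0 => Matrix.of fun _ _ => 0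
  | n + 1 => recast
      (show 2 ^ (n + 1) - 1 = (2 ^ n - 1) + (2 ^ n - 1) + 1 by
        have : 1 ≤ 2 ^ n := Nat.one_le_two_pow
        rw [pow_succ]; omega)
      (glue (fsdmMatrix n) (dual (fsdmMatrix n)))

/-- The step sizes of RDO with period `p`, for all iterations. Row `i` is read off from
`H_{RDO(p)}^{(i)}`, whose size is `i p ≥ i`; see `rdoSteps_eq`. -/
noncomputable def rdoSteps (p : ℕ) (hp : 1 ≤ p) (i j : ℕ) : ℝ := ent (rdoMatrix p hp i) i j

/-- The step sizes of FSDM, for all iterations. Row `i` is read off from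
`H_{FSDM}(2^i - 1)`, where `2^i - 1 ≥ i`; see `fsdmSteps_eq`. -/
noncomputable def fsdmSteps (i j : ℕ) : ℝ := ent (fsdmMatrix i) i j

/-- `H₁` is the upper left block of `H₁ ⋈ H₂`, and the entries to its right vanish. -/
theorem ent_glue {a b : ℕ} (H₁ : Matrix (Fin a) (Fin a) ℝ) (H₂ : Matrix (Fin b) (Fin b) ℝ)
    {i j : ℕ} (hi : i ≤ a) : ent (glue H₁ H₂) i j = ent H₁ i j := by
  by_cases h : (1 ≤ i ∧ i ≤ a + b + 1) ∧ (1 ≤ j ∧ j ≤ a + b + 1)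
  · unfold glue
    rw [ent_ofEnt _ h.1 h.2, if_pos hi]
  · rw [ent_eq_zero _ h, ent_eq_zero]
    omega

theorem ent_rdoMatrix_of_le (p : ℕ) (hp : 1 ≤ p) {m n : ℕ} (hmn : m ≤ n) {i j : ℕ}
    (hi : i ≤ m * p) : ent (rdoMatrix p hp n) i j = ent (rdoMatrix p hp m) i j := by
  induction n, hmn using Nat.le_induction with
  | base => rfl
  | succ n hn ih =>
    rw [rdoMatrix, ent_recast, ent_glue _ _ (hi.trans (Nat.mul_le_mul_right p hn)), ih]

/-- For every `n`, the H-matrix of the first `n p` iterations of RDO is `H_{RDO(p)}^{(n)}`. -/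
theorem rdoSteps_eq (p : ℕ) (hp : 1 ≤ p) (n i j : ℕ) (hi : i ≤ n * p) :
    rdoSteps p hp i j = ent (rdoMatrix p hp n) i j := by
  unfold rdoSteps
  have hi' : i ≤ i * p := Nat.le_mul_of_pos_right i hp
  rcases le_total i n with h | h
  · rw [ent_rdoMatrix_of_le p hp h hi']
  · rw [ent_rdoMatrix_of_le p hp h hi]

theorem ent_fsdmMatrix_of_le {m n : ℕ} (hmn : m ≤ n) {i j : ℕ} (hi : i ≤ 2 ^ m - 1) :
    ent (fsdmMatrix n) i j = ent (fsdmMatrix m) i j := by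
  induction n, hmn using Nat.le_induction with
  | base => rfl
  | succ n hn ih =>
    have : 2 ^ m ≤ 2 ^ n := Nat.pow_le_pow_right (by norm_num) hn
    rw [fsdmMatrix, ent_recast, ent_glue _ _ (by omega), ih]

/-- For every `n`, the H-matrix of the first `2^n - 1` iterations of FSDM is
`H_{FSDM}(2^n - 1)`. -/
theorem fsdmSteps_eq (n i j : ℕ) (hi : i ≤ 2 ^ n - 1) :
    fsdmSteps i j = ent (fsdmMatrix n) i j := by
  unfold fsdmSteps
  have hi' : i ≤ 2 ^ i - 1 := Nat.le_sub_one_of_lt Nat.lt_two_pow_self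
  rcases le_total i n with h | h
  · rw [ent_fsdmMatrix_of_le h hi']
  · rw [ent_fsdmMatrix_of_le h hi]

end HMat

/-!
# Rates of decomposable optimal methods, RDO and FSDM

Throughout `g_k = y_k - T y_k` is the `k`-th residual, `N = n + 1`, and `S` is the strictly lower
triangular matrix (`stepMatrix`) with `y_k = y₀ - ∑_j S_{k,j} g_j`. All three rates follow from the
certificate inequality `N ‖g_n‖² ≤ ⟨g_n, 2 (y₀ - y_n) + g_n⟩` (`Certified`): adding the
nonexpansiveness of `T` between `y_n` and `y⋆` gives `N ‖g_n‖² ≤ 2 ⟨g_n, y₀ - y⋆⟩`, and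
Cauchy-Schwarz does the rest (`Certified.rate`).

**Decomposable optimal methods.** The Q-functions are the last rows of the powers of `S`
(`stepMatrix_pow_last`). Hence the H-certificates are, up to sign, the off-diagonal entries of the
symmetric matrix `M` (`certMatrix`) that solves the Stein equation `M S + Sᵀ M + M = N e_n e_nᵀ`
(`certMatrix_stein`). Optimality forces `M` to have row sums `e_n` and nonpositive off-diagonal
entries (`certMatrix_of_mem_optimalSet`). Indeed, the negacyclic shift of `ℝ^N`, started at the
all-ones vector, is a worst case for every method; all interpolation inequalities are tight, and the
residuals of an optimal method are linearly independent. Perturb this instance to first order, so that every interpolation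
inequality acquires a positive derivative; by Kirszbraun's theorem
(`exists_lipschitzWith_one_extension`) small perturbations are again instances, and optimality
bounds the derivative of the objective. The admissible perturbations are the solutions of the
transposed Stein equation, so the bounds dualise to the two conditions on `M`.

If `H` is decomposable at `N' = a + 1`, then `M` couples the indices `≤ a` to the indices `> a` by
the single entry `-c < 0` at `(n, a)` (`certMatrix_block`). The Stein equation is an identity of
quadratic forms in arbitrary vectors `g_0, …, g_n`. Substituting the residuals for the first block
and the constant `c / (1 + c) • g_a` for the second one annihilates the rows `> a` of `M g`, and
leaves the certificate inequality at `a`, provided that `c / (1 + c) ≥ N' / N`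
(`certified_initial_block`). This bound on `c` comes from inserting the worst-case instance of
dimension `N - N'` into the second block (`coupling_lower_bound`).

**RDO and FSDM.** The linear system that defines the glued column has the solution
`-(N' / N) ∑_l (H₂)_{s,l}`, by the invariants `∑_j Q(m, j; H₂) = binom(N₂, m + 1) / N₂` of `H₂`,
`N₂ = N - N'` (`sum_glueCol`, `glueCol_succ`). These invariants are encoded in `Regular`, and
gluing preserves them (`regular_glue`). Consequently the second block of `H₁ ⋈ H₂` runs the method
of `H₂` on `T + (N' / N) g`, where `g` is the residual at the end of the first block
(`iter_glue_right`). A positive combination of the certificate inequalities of the two blocks and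
of nonexpansiveness between their last iterates is the certificate inequality of `H₁ ⋈ H₂`
(`certified_glue`). Dual-OHM itself is an iterated gluing with the empty matrix (`dualOHM_succ`),
and the FSDM matrices are self-dual (`selfDual_glue`), so everything is obtained by gluing, starting
from empty matrices.
-/

namespace HMat

open Finset

/-! ### Kirszbraun extension in finite dimension -/

/-- The double sum `∑ w_i w_j ‖p_i - p_j‖²` in terms of the distances to a point `z` and the
displacement of the barycentre. -/
theorem sum_sum_mul_norm_sub_sq {V ι : Type*} [NormedAddCommGroup V] [InnerProductSpace ℝ V]
    [Fintype ι] (w : ι → ℝ) (hw : ∑ i, w i = 1) (p : ι → V) (z : V) :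
    ∑ i, ∑ j, w i * w j * ‖p i - p j‖ ^ 2 =
      2 * ∑ i, w i * ‖z - p i‖ ^ 2 - 2 * ‖∑ i, w i • (z - p i)‖ ^ 2 := by
  have h1 : ∀ i j, ‖p i - p j‖ ^ 2 =
      ‖z - p i‖ ^ 2 + ‖z - p j‖ ^ 2 - 2 * inner ℝ (z - p i) (z - p j) := by
    intro i j
    have : p i - p j = (z - p j) - (z - p i) := by abel
    rw [this, norm_sub_sq_real, real_inner_comm]; ring
  have h2 : ‖∑ i, w i • (z - p i)‖ ^ 2 =
      ∑ i, ∑ j, w i * w j * inner ℝ (z - p i) (z - p j) := by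
    rw [← real_inner_self_eq_norm_sq, sum_inner]
    refine sum_congr rfl fun i _ => ?_
    rw [inner_sum]
    refine sum_congr rfl fun j _ => ?_
    rw [real_inner_smul_left, real_inner_smul_right]; ring
  have h3 : ∑ i, ∑ j, w i * w j * ‖z - p i‖ ^ 2 = ∑ i, w i * ‖z - p i‖ ^ 2 := by
    refine sum_congr rfl fun i _ => ?_
    have : ∀ j, w i * w j * ‖z - p i‖ ^ 2 = w j * (w i * ‖z - p i‖ ^ 2) := fun j => by ring
    simp_rw [this]
    rw [← sum_mul, hw, one_mul]
  have h4 : ∑ i, ∑ j, w i * w j * ‖z - p j‖ ^ 2 = ∑ i, w i * ‖z - p i‖ ^ 2 := by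
    have : ∀ i, ∑ j, w i * w j * ‖z - p j‖ ^ 2 = w i * ∑ j, w j * ‖z - p j‖ ^ 2 := by
      intro i
      rw [mul_sum]
      exact sum_congr rfl fun j _ => by ring
    simp_rw [this]
    rw [← sum_mul, hw, one_mul]
  have h5 : ∀ i j, w i * w j * ‖p i - p j‖ ^ 2 = w i * w j * ‖z - p i‖ ^ 2 +
      w i * w j * ‖z - p j‖ ^ 2 - 2 * (w i * w j * inner ℝ (z - p i) (z - p j)) := by
    intro i j; rw [h1]; ring
  simp_rw [h5, sum_sub_distrib, sum_add_distrib]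
  rw [h3, h4, h2]
  simp_rw [← mul_sum]
  ring

/-- Finitely many closed balls whose centres are mutually at most as far apart as the points `x i`,
and whose radii are the distances of the `x i` to `z`, have a common point. The point is one half
of a saddle point of `(c, w) ↦ ∑ w_i (‖c - u_i‖² - ‖z - x_i‖²)`; the value at the saddle point is
nonpositive by comparison with the barycentre `∑ w_i u_i`. -/
theorem exists_forall_norm_sub_le_of_fintype {V ι : Type*} [NormedAddCommGroup V]
    [InnerProductSpace ℝ V] [Fintype ι] [Nonempty ι] (x u : ι → V)
    (h : ∀ i j, ‖u i - u j‖ ≤ ‖x i - x j‖) (z : V) :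
    ∃ c, ∀ i, ‖c - u i‖ ≤ ‖z - x i‖ := by
  classical
  let f : V → (ι → ℝ) → ℝ := fun c w => ∑ i, w i * (‖c - u i‖ ^ 2 - ‖z - x i‖ ^ 2)
  have hcont : Continuous fun q : V × (ι → ℝ) => f q.1 q.2 := by fun_prop
  have hconv : ∀ i, ConvexOn ℝ Set.univ fun c : V => ‖c - u i‖ ^ 2 - ‖z - x i‖ ^ 2 := by
    intro i
    have h1 : ConvexOn ℝ Set.univ fun c : V => ‖c - u i‖ := by
      have := (convexOn_univ_norm (E := V)).translate_left (-(u i))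
      simpa [Function.comp_def, sub_eq_add_neg, add_comm] using this
    have h2 := h1.pow (fun _ _ => norm_nonneg _) 2
    exact h2.add_const (-‖z - x i‖ ^ 2)
  obtain ⟨c, -, w, hw, hcw⟩ := Sion.exists_isSaddlePointOn
    (X := convexHull ℝ (Set.range u)) (Y := stdSimplex ℝ ι) (f := f)
    ((Set.range_nonempty u).convexHull) (convex_convexHull ℝ _)
    ((Set.finite_range u).isCompact_convexHull (𝕜 := ℝ))
    (fun w _ => (hcont.comp (by fun_prop : Continuous fun c : V => (c, w))).lowerSemicontinuous
      |>.lowerSemicontinuousOn _)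
    (fun w hw => by
      have : ConvexOn ℝ (convexHull ℝ (Set.range u)) fun c => f c w := by
        refine ⟨convex_convexHull ℝ _, fun c _ d _ a b ha hb hab => ?_⟩
        simp only [f, smul_eq_mul, mul_sum, ← sum_add_distrib]
        refine sum_le_sum fun i _ => ?_
        have := (hconv i).2 (Set.mem_univ c) (Set.mem_univ d) ha hb hab
        simp only [smul_eq_mul] at this
        calc _ ≤ w i * _ := mul_le_mul_of_nonneg_left this (hw.1 i)
          _ = _ := by ring
      exact this.quasiconvexOn)
    (convex_stdSimplex ℝ ι) ⟨_, single_mem_stdSimplex ℝ (Classical.arbitrary ι)⟩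
    (isCompact_stdSimplex ℝ ι)
    (fun c _ => (hcont.comp (by fun_prop : Continuous fun w : ι → ℝ => (c, w))).upperSemicontinuous
      |>.upperSemicontinuousOn _)
    (fun c _ => by
      have : ConcaveOn ℝ (stdSimplex ℝ ι) fun w => f c w := by
        refine ⟨convex_stdSimplex ℝ ι, fun v _ w _ a b _ _ _ => le_of_eq ?_⟩
        simp only [f, smul_eq_mul, Pi.add_apply, Pi.smul_apply, add_mul, sum_add_distrib, mul_sum,
          mul_assoc]
      exact this.quasiconcaveOn)
  refine ⟨c, fun i => ?_⟩
  have hbar : ∑ j, w j • u j ∈ convexHull ℝ (Set.range u) := by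
    refine (convex_convexHull ℝ _).sum_mem (fun j _ => hw.1 j) hw.2 fun j _ => ?_
    exact subset_convexHull ℝ _ ⟨j, rfl⟩
  have key := hcw _ hbar _ (single_mem_stdSimplex ℝ i)
  have h1 : f c (Pi.single i 1) = ‖c - u i‖ ^ 2 - ‖z - x i‖ ^ 2 := by
    simp [f, Pi.single_apply]
  have h2 : f (∑ j, w j • u j) w ≤ 0 := by
    set b := ∑ j, w j • u j with hb
    have e1 := sum_sum_mul_norm_sub_sq w hw.2 u b
    have e2 := sum_sum_mul_norm_sub_sq w hw.2 x z
    have e3 : ∑ j, w j • (b - u j) = 0 := by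
      simp_rw [smul_sub, sum_sub_distrib]
      rw [← sum_smul, hw.2, one_smul, ← hb, sub_self]
    have e4 : ∑ i, ∑ j, w i * w j * ‖u i - u j‖ ^ 2 ≤ ∑ i, ∑ j, w i * w j * ‖x i - x j‖ ^ 2 := by
      refine sum_le_sum fun i _ => sum_le_sum fun j _ => ?_
      exact mul_le_mul_of_nonneg_left (pow_le_pow_left₀ (norm_nonneg _) (h i j) 2)
        (mul_nonneg (hw.1 i) (hw.1 j))
    rw [e1, e2, e3] at e4
    have e5 : f b w = ∑ i, w i * ‖b - u i‖ ^ 2 - ∑ i, w i * ‖z - x i‖ ^ 2 := by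
      simp only [f, mul_sub, sum_sub_distrib]
    rw [e5]
    simp only [norm_zero] at e4
    nlinarith [sq_nonneg ‖∑ i, w i • (z - x i)‖]
  rw [h1] at key
  exact le_of_sq_le_sq (by linarith) (norm_nonneg _)

/-- The ball intersection property for an arbitrary nonexpansive relation, by compactness of closed
balls. -/
theorem exists_forall_norm_sub_le {V : Type*} [NormedAddCommGroup V] [InnerProductSpace ℝ V]
    [FiniteDimensional ℝ V] (G : Set (V × V))
    (hG : ∀ p ∈ G, ∀ q ∈ G, ‖p.2 - q.2‖ ≤ ‖p.1 - q.1‖) (z : V) :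
    ∃ c, ∀ p ∈ G, ‖c - p.2‖ ≤ ‖z - p.1‖ := by
  classical
  rcases G.eq_empty_or_nonempty with rfl | ⟨p₀, hp₀⟩
  · exact ⟨0, by simp⟩
  have : ProperSpace V := FiniteDimensional.proper ℝ V
  let t : G → Set V := fun p => Metric.closedBall p.1.2 ‖z - p.1.1‖
  have hne := (isCompact_closedBall p₀.2 ‖z - p₀.1‖).inter_iInter_nonempty t
    (fun _ => Metric.isClosed_closedBall) (fun F => by
      let F' : Finset G := insert ⟨p₀, hp₀⟩ F
      have : Nonempty F' := ⟨⟨_, mem_insert_self _ _⟩⟩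
      obtain ⟨c, hc⟩ := exists_forall_norm_sub_le_of_fintype (ι := F') (fun i => i.1.1.1)
        (fun i => i.1.1.2) (fun i j => hG _ i.1.2 _ j.1.2) z
      refine ⟨c, ?_, ?_⟩
      · rw [Metric.mem_closedBall, dist_eq_norm]
        exact hc ⟨⟨p₀, hp₀⟩, mem_insert_self _ _⟩
      · simp only [Set.mem_iInter]
        intro p hp
        rw [Metric.mem_closedBall, dist_eq_norm]
        exact hc ⟨p, mem_insert_of_mem hp⟩)
  obtain ⟨c, -, hc⟩ := hne
  refine ⟨c, fun p hp => ?_⟩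
  have := Set.mem_iInter.1 hc ⟨p, hp⟩
  rwa [Metric.mem_closedBall, dist_eq_norm] at this

/-- **Kirszbraun's theorem** in finite dimension, for graphs: a nonexpansive relation is contained
in the graph of a nonexpansive map. -/
theorem exists_lipschitzWith_one_extension {V : Type*} [NormedAddCommGroup V]
    [InnerProductSpace ℝ V] [FiniteDimensional ℝ V] (G : Set (V × V))
    (hG : ∀ p ∈ G, ∀ q ∈ G, ‖p.2 - q.2‖ ≤ ‖p.1 - q.1‖) :
    ∃ T : V → V, LipschitzWith 1 T ∧ ∀ p ∈ G, T p.1 = p.2 := by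
  obtain ⟨M, hGM, hM⟩ := zorn_subset_nonempty
    {R : Set (V × V) | ∀ p ∈ R, ∀ q ∈ R, ‖p.2 - q.2‖ ≤ ‖p.1 - q.1‖}
    (fun c hc hch _ => ⟨⋃₀ c, by
      rintro p ⟨s, hs, hp⟩ q ⟨t, ht, hq⟩
      rcases hch.total hs ht with hst | hts
      · exact hc ht p (hst hp) q hq
      · exact hc hs p hp q (hts hq), fun s hs => Set.subset_sUnion_of_mem hs⟩) G hG
  have hMl := hM.prop
  have htot : ∀ z, ∃ c, (z, c) ∈ M := by
    intro z
    obtain ⟨c, hc⟩ := exists_forall_norm_sub_le M hMl z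
    refine ⟨c, ?_⟩
    have hins : insert (z, c) M ∈
        {R : Set (V × V) | ∀ p ∈ R, ∀ q ∈ R, ‖p.2 - q.2‖ ≤ ‖p.1 - q.1‖} := by
      rintro p (rfl | hp) q (rfl | hq)
      · simp
      · exact hc q hq
      · rw [norm_sub_rev, norm_sub_rev p.1]; exact hc p hp
      · exact hMl p hp q hq
    exact hM.le_of_ge hins (Set.subset_insert _ _) (Set.mem_insert _ _)
  choose T hT using htot
  refine ⟨T, LipschitzWith.of_dist_le_mul fun x y => ?_, fun p hp => ?_⟩
  · simpa [dist_eq_norm] using hMl _ (hT x) _ (hT y)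
  · have := hMl _ (hT p.1) p (hGM hp)
    simpa [sub_eq_zero] using this

/-! ### Fixed-step methods and their residuals -/

/-- The residual `y_k - T y_k` of the iterate `y_k`. -/
noncomputable def resid {X : Type*} [AddCommGroup X] [Module ℝ X] (h : ℕ → ℕ → ℝ) (T : X → X)
    (y₀ : X) (k : ℕ) : X :=
  iter h T y₀ k - T (iter h T y₀ k)

/-- The accumulated step sizes `∑_{i=j+1}^{k} h_{i,j+1}`, indexed from `0`: the coefficient of the
`j`-th residual in `y₀ - y_k`. -/
def stepSum (h : ℕ → ℕ → ℝ) (k j : ℕ) : ℝ := ∑ i ∈ Icc (j + 1) k, h i (j + 1)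

theorem stepSum_eq_zero (h : ℕ → ℕ → ℝ) {k j : ℕ} (hkj : k ≤ j) : stepSum h k j = 0 := by
  rw [stepSum, Icc_eq_empty (by omega), sum_empty]

theorem stepSum_succ (h : ℕ → ℕ → ℝ) {k j : ℕ} (hjk : j ≤ k) :
    stepSum h (k + 1) j = stepSum h k j + h (k + 1) (j + 1) := by
  rw [stepSum, sum_Icc_succ_top (by omega), stepSum]

section Iter

variable {X : Type*} [AddCommGroup X] [Module ℝ X]

theorem iter_zero (h : ℕ → ℕ → ℝ) (T : X → X) (y₀ : X) : iter h T y₀ 0 = y₀ := by rw [iter]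

theorem iter_succ (h : ℕ → ℕ → ℝ) (T : X → X) (y₀ : X) (k : ℕ) :
    iter h T y₀ (k + 1) =
      iter h T y₀ k - ∑ j ∈ range (k + 1), h (k + 1) (j + 1) • resid h T y₀ j := by
  rw [iter, sum_range]; rfl

theorem iter_eq_sub_sum (h : ℕ → ℕ → ℝ) (T : X → X) (y₀ : X) (k : ℕ) :
    iter h T y₀ k = y₀ - ∑ j ∈ range k, stepSum h k j • resid h T y₀ j := by
  induction k with
  | zero => simp [iter]
  | succ k ih =>
    have h1 : ∑ j ∈ range (k + 1), stepSum h (k + 1) j • resid h T y₀ j =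
        ∑ j ∈ range (k + 1), stepSum h k j • resid h T y₀ j +
          ∑ j ∈ range (k + 1), h (k + 1) (j + 1) • resid h T y₀ j := by
      rw [← sum_add_distrib]
      refine sum_congr rfl fun j hj => ?_
      rw [stepSum_succ h (by have := mem_range.1 hj; omega), add_smul]
    rw [iter_succ, ih, h1, sum_range_succ (fun j => stepSum h k j • resid h T y₀ j),
      stepSum_eq_zero h le_rfl, zero_smul, add_zero, sub_sub]

/-- The iterates are characterised by their recursion. -/
theorem iter_eq_of_recursion (h : ℕ → ℕ → ℝ) (T : X → X) (y : ℕ → X) (n : ℕ)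
    (hy : ∀ k < n, y (k + 1) = y k - ∑ j ∈ range (k + 1), h (k + 1) (j + 1) • (y j - T (y j))) :
    ∀ k ≤ n, iter h T (y 0) k = y k := by
  intro k
  induction k using Nat.strong_induction_on with
  | _ k ih =>
    intro hk
    cases k with
    | zero => exact iter_zero ..
    | succ k =>
      rw [iter_succ, hy k (by omega), ih k (by omega) (by omega)]
      congr 1
      refine sum_congr rfl fun j hj => ?_
      have := mem_range.1 hj
      rw [resid, ih j (by omega) (by omega)]

/-- Only the step sizes `h_{i,j}`, `1 ≤ j ≤ i ≤ n`, enter the first `n` iterations. -/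
theorem iter_congr {h h' : ℕ → ℕ → ℝ} (T : X → X) (y₀ : X) (n : ℕ)
    (hh : ∀ i j, 1 ≤ j → j ≤ i → i ≤ n → h i j = h' i j) :
    iter h T y₀ n = iter h' T y₀ n := by
  have key := iter_eq_of_recursion h T (iter h' T y₀) n (fun k hk => ?_) n le_rfl
  · rwa [iter_zero] at key
  rw [iter_succ]
  congr 1
  refine sum_congr rfl fun j hj => ?_
  have := mem_range.1 hj
  rw [hh _ _ (by omega) (by omega) (by omega)]; rfl

end Iter

/-! ### The negacyclic shift as a worst-case operator -/

/-- The negacyclic shift `e_i ↦ e_{i+1}`, `e_n ↦ -e_0`, of `ℝ^{n+1}`. -/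
noncomputable def negShift (n : ℕ) (v : EuclideanSpace ℝ (Fin (n + 1))) :
    EuclideanSpace ℝ (Fin (n + 1)) :=
  WithLp.toLp 2 (Fin.cons (-v (Fin.last n)) fun i : Fin n => v i.castSucc)

/-- The all-ones vector of `ℝ^{n+1}`, the worst-case starting point. -/
noncomputable def onesVec (n : ℕ) : EuclideanSpace ℝ (Fin (n + 1)) := WithLp.toLp 2 fun _ => 1

theorem negShift_zero_apply {n : ℕ} (v : EuclideanSpace ℝ (Fin (n + 1))) :
    negShift n v 0 = -v (Fin.last n) := rfl

theorem negShift_succ_apply {n : ℕ} (v : EuclideanSpace ℝ (Fin (n + 1))) (i : Fin n) :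
    negShift n v i.succ = v i.castSucc := rfl

theorem negShift_sub {n : ℕ} (v w : EuclideanSpace ℝ (Fin (n + 1))) :
    negShift n v - negShift n w = negShift n (v - w) := by
  ext i
  refine Fin.cases ?_ (fun i => ?_) i
  · simp only [PiLp.sub_apply, negShift_zero_apply]; ring
  · simp only [PiLp.sub_apply, negShift_succ_apply]

theorem negShift_zero (n : ℕ) : negShift n 0 = 0 := by
  have := negShift_sub (0 : EuclideanSpace ℝ (Fin (n + 1))) 0
  rw [sub_self, sub_self] at this
  exact this.symm

theorem norm_negShift {n : ℕ} (v : EuclideanSpace ℝ (Fin (n + 1))) : ‖negShift n v‖ = ‖v‖ := by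
  rw [← sq_eq_sq₀ (norm_nonneg _) (norm_nonneg _), EuclideanSpace.real_norm_sq_eq,
    EuclideanSpace.real_norm_sq_eq, Fin.sum_univ_succ, Fin.sum_univ_castSucc]
  simp only [negShift_zero_apply, negShift_succ_apply]
  ring

theorem lipschitzWith_negShift (n : ℕ) : LipschitzWith 1 (negShift n) :=
  LipschitzWith.of_dist_le_mul fun v w => by
    rw [dist_eq_norm, dist_eq_norm, negShift_sub, norm_negShift]; simp

theorem norm_onesVec_sq (n : ℕ) : ‖onesVec n‖ ^ 2 = (n : ℝ) + 1 := by
  simp [EuclideanSpace.real_norm_sq_eq, onesVec]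

theorem inner_onesVec {n : ℕ} (v : EuclideanSpace ℝ (Fin (n + 1))) :
    inner ℝ v (onesVec n) = ∑ i, v i := by
  simp [PiLp.inner_apply, onesVec]

/-- The negacyclic shift preserves distances, so nonexpansiveness holds with equality. -/
theorem inner_sub_negShift {n : ℕ} (v : EuclideanSpace ℝ (Fin (n + 1))) :
    2 * inner ℝ v (v - negShift n v) = ‖v - negShift n v‖ ^ 2 := by
  have h := norm_sub_sq_real v (negShift n v)
  rw [norm_negShift] at h
  rw [h, inner_sub_right, real_inner_self_eq_norm_sq]; ring

section NegShiftIter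

variable (h : ℕ → ℕ → ℝ) {n : ℕ}

/-- The `k`-th iterate differs from the all-ones vector in the coordinates `i < k` only. -/
theorem iter_negShift_apply {k : ℕ} (hk : k ≤ n) (i : Fin (n + 1)) (hi : k ≤ i) :
    iter h (negShift n) (onesVec n) k i = 1 ∧
      (k < i → resid h (negShift n) (onesVec n) k i = 0) := by
  induction k using Nat.strong_induction_on generalizing i with
  | _ k ih =>
    have key : ∀ i : Fin (n + 1), k ≤ i → iter h (negShift n) (onesVec n) k i = 1 := by
      intro i hi
      cases k with
      | zero => rw [iter_zero]; rfl
      | succ k =>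
        rw [iter_succ, PiLp.sub_apply, (ih k (by omega) (by omega) i (by omega)).1, WithLp.ofLp_sum,
          Finset.sum_apply, sum_eq_zero, sub_zero]
        intro j hj
        have := mem_range.1 hj
        rw [PiLp.smul_apply, (ih j (by omega) (by omega) i (by omega)).2 (by omega), smul_zero]
    refine ⟨key i hi, fun hki => ?_⟩
    obtain ⟨i', rfl⟩ := Fin.exists_succ_eq.2 (show i ≠ 0 by rintro rfl; simp at hki)
    rw [resid, PiLp.sub_apply, negShift_succ_apply, key _ hi, key, sub_self]
    simp only [Fin.val_succ] at hki
    simp only [Fin.val_castSucc]; omega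

theorem inner_resid_negShift {k : ℕ} (hk : k ≤ n) :
    inner ℝ (resid h (negShift n) (onesVec n) k) (onesVec n) = 2 := by
  rw [inner_onesVec]
  set y := iter h (negShift n) (onesVec n) k with hy
  have h1 : ∑ i, resid h (negShift n) (onesVec n) k i = ∑ i, y i - ∑ i, negShift n y i := by
    rw [← sum_sub_distrib]; rfl
  rw [h1, Fin.sum_univ_castSucc, Fin.sum_univ_succ (fun i => negShift n y i)]
  simp only [negShift_zero_apply, negShift_succ_apply]
  have : y (Fin.last n) = 1 := (iter_negShift_apply h hk (Fin.last n) (by simpa using hk)).1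
  rw [this]; ring

/-- The leading coordinates of the residuals are the products of the diagonal step sizes. -/
theorem resid_negShift_diag_succ {k : ℕ} (hk : k + 1 ≤ n) :
    resid h (negShift n) (onesVec n) (k + 1) ⟨k + 1, by omega⟩ =
      h (k + 1) (k + 1) * resid h (negShift n) (onesVec n) k ⟨k, by omega⟩ := by
  have e : (⟨k + 1, by omega⟩ : Fin (n + 1)) = Fin.succ ⟨k, by omega⟩ := rfl
  have e' : (Fin.castSucc ⟨k, by omega⟩ : Fin (n + 1)) = ⟨k, by omega⟩ := rfl
  rw [resid, PiLp.sub_apply, (iter_negShift_apply h hk ⟨k + 1, by omega⟩ le_rfl).1, e,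
    negShift_succ_apply, e', iter_succ, PiLp.sub_apply,
    (iter_negShift_apply h (by omega) ⟨k, by omega⟩ le_rfl).1, WithLp.ofLp_sum, Finset.sum_apply,
    sum_range_succ, sum_eq_zero, PiLp.smul_apply, smul_eq_mul]
  · ring
  · intro j hj
    have := mem_range.1 hj
    rw [PiLp.smul_apply, (iter_negShift_apply h (by omega) ⟨k, by omega⟩
      (by simp only; omega)).2 (by simpa using this), smul_zero]

/-- If the leading coordinate of the last residual does not vanish, the residuals form a basis:
a vector with prescribed inner products exists. -/
theorem exists_inner_resid_negShift
    (hn : resid h (negShift n) (onesVec n) n (Fin.last n) ≠ 0) (w : Fin (n + 1) → ℝ) :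
    ∃ r, ∀ k : Fin (n + 1), inner ℝ (resid h (negShift n) (onesVec n) k) r = w k := by
  have hd : ∀ d k : ℕ, (hk : k ≤ n) → k + d = n →
      resid h (negShift n) (onesVec n) k ⟨k, by omega⟩ ≠ 0 := by
    intro d
    induction d with
    | zero => rintro k hk rfl; exact hn
    | succ d ih =>
      intro k hk hkd
      have := ih (k + 1) (by omega) (by omega)
      rw [resid_negShift_diag_succ h (by omega)] at this
      exact right_ne_zero_of_mul this
  let B : Matrix (Fin (n + 1)) (Fin (n + 1)) ℝ :=
    Matrix.of fun k i => resid h (negShift n) (onesVec n) k i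
  have hB : IsUnit B := by
    rw [Matrix.isUnit_iff_isUnit_det, Matrix.det_of_isLowerTriangular B, isUnit_iff_ne_zero,
      prod_ne_zero_iff]
    · exact fun k _ => hd (n - k) k (by omega) (by omega)
    · intro k i hki
      have : k < i := hki
      exact (iter_negShift_apply h (by omega) i (by omega)).2 this
  obtain ⟨r, hr⟩ := Matrix.mulVec_surjective_iff_isUnit.2 hB w
  refine ⟨WithLp.toLp 2 r, fun k => ?_⟩
  rw [← hr, PiLp.inner_apply]
  simp [Matrix.mulVec, dotProduct, B, mul_comm]

end NegShiftIter

/-- An optimal method has the residual `(2 / N) y₀` on the worst-case instance. -/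
theorem resid_negShift_of_mem_optimalSet {n : ℕ} {H : Matrix (Fin n) (Fin n) ℝ}
    (hH : H ∈ optimalSet n) :
    resid (ent H) (negShift n) (onesVec n) n = (2 / ((n : ℝ) + 1)) • onesVec n := by
  have h1 := hH.2 _ _ (lipschitzWith_negShift n) (onesVec n) 0 (negShift_zero n)
  have hN : (0 : ℝ) < (n : ℝ) + 1 := by positivity
  rw [sub_zero, norm_onesVec_sq] at h1
  have h2 := inner_resid_negShift (ent H) (le_refl n)
  change ‖resid (ent H) (negShift n) (onesVec n) n‖ ^ 2 ≤ _ at h1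
  rw [← sub_eq_zero, ← norm_eq_zero, ← sq_eq_zero_iff]
  refine le_antisymm ?_ (sq_nonneg _)
  rw [norm_sub_sq_real, real_inner_smul_right, h2, norm_smul, mul_pow, norm_onesVec_sq,
    Real.norm_eq_abs, sq_abs]
  have : 4 * ((n : ℝ) + 1) / ((n : ℝ) + 1) ^ 2 = 4 / ((n : ℝ) + 1) := by field_simp
  rw [this] at h1
  have e : 2 * (2 / ((n : ℝ) + 1) * 2) - (2 / ((n : ℝ) + 1)) ^ 2 * ((n : ℝ) + 1) =
    4 / ((n : ℝ) + 1) := by field_simp; norm_num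
  linarith

/-! ### The step matrix, the Q-functions and the certificate matrix -/

/-- The strictly lower triangular `N × N` matrix of accumulated step sizes, `N = n + 1`:
`y_k = y₀ - ∑_j S_{k,j} (y_j - T y_j)`. -/
noncomputable def stepMatrix {n : ℕ} (H : Matrix (Fin n) (Fin n) ℝ) :
    Matrix (Fin (n + 1)) (Fin (n + 1)) ℝ :=
  Matrix.of fun k j => stepSum (ent H) k j

theorem Q_eq_zero {n : ℕ} (H : Matrix (Fin n) (Fin n) ℝ) (m : ℕ) {j : ℕ} (hj : n < j) :
    Q H m j = 0 := by
  match m with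
  | 0 => rw [Q]
  | 1 => rw [Q, Icc_eq_empty (by omega), sum_empty]
  | m + 2 => rw [Q, Icc_eq_empty (by omega), sum_empty]

theorem Q_one {n : ℕ} (H : Matrix (Fin n) (Fin n) ℝ) (j : ℕ) :
    Q H 1 (j + 1) = stepSum (ent H) n j := by
  rw [Q, stepSum]

/-- The recursion of the Q-functions, organised by the last factor. -/
theorem Q_succ_succ {n : ℕ} (H : Matrix (Fin n) (Fin n) ℝ) (m j : ℕ) :
    Q H (m + 2) (j + 1) = ∑ l ∈ range (n + 1), Q H (m + 1) (l + 1) * stepSum (ent H) l j := by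
  have h1 : ∀ i, ∑ j' ∈ Icc (i + 1) n, Q H (m + 1) j' =
      ∑ l ∈ Icc i n, Q H (m + 1) (l + 1) := by
    intro i
    rw [← sum_image (s := Icc i n) (g := fun l => l + 1) (f := fun j' => Q H (m + 1) j')
      (by intro a _ b _ h; simpa using h)]
    refine sum_subset (fun x hx => ?_) (fun x hx hx' => ?_)
    · have := mem_Icc.1 hx
      exact mem_image.2 ⟨x - 1, mem_Icc.2 ⟨by omega, by omega⟩, by omega⟩
    · obtain ⟨l, hl, rfl⟩ := mem_image.1 hx
      have := mem_Icc.1 hl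
      rw [mem_Icc] at hx'
      exact Q_eq_zero H _ (by omega)
  rw [Q]
  simp_rw [h1, stepSum, mul_sum]
  rw [sum_sigma', sum_sigma']
  refine sum_bij' (fun x _ => ⟨x.2, x.1⟩) (fun x _ => ⟨x.2, x.1⟩) ?_ ?_ ?_ ?_ ?_
  · rintro ⟨i, l⟩ hx
    simp only [mem_sigma, mem_Icc, mem_range] at hx ⊢
    omega
  · rintro ⟨l, i⟩ hx
    simp only [mem_sigma, mem_Icc, mem_range] at hx ⊢
    omega
  · simp
  · simp
  · rintro ⟨i, l⟩ _
    exact mul_comm _ _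

/-- The Q-functions are the last rows of the powers of the step matrix. -/
theorem stepMatrix_pow_last {n : ℕ} (H : Matrix (Fin n) (Fin n) ℝ) (m : ℕ) (j : Fin (n + 1)) :
    (stepMatrix H ^ (m + 1)) (Fin.last n) j = Q H (m + 1) (j + 1) := by
  induction m generalizing j with
  | zero => rw [zero_add, pow_one, Q_one]; rfl
  | succ m ih =>
    rw [pow_succ, Matrix.mul_apply, Q_succ_succ, sum_range]
    exact sum_congr rfl fun l _ => by rw [ih]; rfl

theorem strictLower_pow_eq_zero {n : ℕ} {S : Matrix (Fin n) (Fin n) ℝ}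
    (hS : ∀ k j, k ≤ j → S k j = 0) (m : ℕ) (k j : Fin n) (hk : (k : ℕ) < j + m) :
    (S ^ m) k j = 0 := by
  induction m generalizing k j with
  | zero => rw [pow_zero, Matrix.one_apply_ne (by rintro rfl; omega)]
  | succ m ih =>
    rw [pow_succ', Matrix.mul_apply]
    refine sum_eq_zero fun l _ => ?_
    rcases le_or_gt k l with h | h
    · rw [hS k l h, zero_mul]
    · rw [ih l j (by have : (l : ℕ) < k := h; omega), mul_zero]

theorem strictLower_pow_card {n : ℕ} {S : Matrix (Fin n) (Fin n) ℝ}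
    (hS : ∀ k j, k ≤ j → S k j = 0) : S ^ n = 0 := by
  ext k j
  exact strictLower_pow_eq_zero hS n k j (by omega)

theorem stepMatrix_eq_zero {n : ℕ} (H : Matrix (Fin n) (Fin n) ℝ) {k j : Fin (n + 1)}
    (hkj : k ≤ j) : stepMatrix H k j = 0 :=
  stepSum_eq_zero _ hkj

theorem stepMatrix_pow_card {n : ℕ} (H : Matrix (Fin n) (Fin n) ℝ) :
    stepMatrix H ^ (n + 1) = 0 :=
  strictLower_pow_card fun _ _ h => stepMatrix_eq_zero H h

/-- The coefficients `(-1)^{l+m} binom(l+m, m)` invert the operator `1 + L + R`, where `L` and `R`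
are the shifts in the two indices of a sequence that vanishes from `N` on. -/
theorem sum_neg_one_pow_choose_shift (N : ℕ) (a b : ℕ → ℝ) (ha : a (N + 1) = 0)
    (hb : b (N + 1) = 0) :
    ∑ l ∈ range (N + 1), ∑ m ∈ range (N + 1), (-1 : ℝ) ^ (l + m) * ((l + m).choose m : ℝ) *
      (a (l + 1) * b m + a l * b (m + 1) + a l * b m) = a 0 * b 0 := by
  let c : ℕ → ℕ → ℝ := fun l m => (-1 : ℝ) ^ (l + m) * ((l + m).choose m : ℝ)
  have shift : ∀ (d a : ℕ → ℝ), a (N + 1) = 0 → ∑ l ∈ range (N + 1), d l * a (l + 1) =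
      ∑ l ∈ range (N + 1), (if l = 0 then 0 else d (l - 1)) * a l := by
    intro d a ha
    have h1 := sum_range_succ' (fun l => (if l = 0 then 0 else d (l - 1)) * a l) (N + 1)
    rw [sum_range_succ, ha] at h1
    simp only [mul_zero, add_zero, if_true, zero_mul] at h1
    rw [h1]
    exact sum_congr rfl fun l _ => by simp
  have e1 : ∑ l ∈ range (N + 1), ∑ m ∈ range (N + 1), c l m * (a (l + 1) * b m) =
      ∑ l ∈ range (N + 1), ∑ m ∈ range (N + 1),
        (if l = 0 then 0 else c (l - 1) m) * (a l * b m) := by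
    rw [sum_comm, sum_comm (s := range (N + 1)) (t := range (N + 1))
      (f := fun l m => (if l = 0 then 0 else c (l - 1) m) * (a l * b m))]
    refine sum_congr rfl fun m _ => ?_
    have := shift (fun l => c l m * b m) a ha
    calc _ = ∑ l ∈ range (N + 1), c l m * b m * a (l + 1) := sum_congr rfl fun l _ => by ring
      _ = _ := by
        rw [this]
        refine sum_congr rfl fun l _ => ?_
        split_ifs <;> ring
  have e2 : ∑ l ∈ range (N + 1), ∑ m ∈ range (N + 1), c l m * (a l * b (m + 1)) =
      ∑ l ∈ range (N + 1), ∑ m ∈ range (N + 1),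
        (if m = 0 then 0 else c l (m - 1)) * (a l * b m) := by
    refine sum_congr rfl fun l _ => ?_
    have := shift (fun m => c l m * a l) b hb
    calc _ = ∑ m ∈ range (N + 1), c l m * a l * b (m + 1) := sum_congr rfl fun m _ => by ring
      _ = _ := by
        rw [this]
        refine sum_congr rfl fun l _ => ?_
        split_ifs <;> ring
  have hrec : ∀ l m, (if l = 0 then 0 else c (l - 1) m) + (if m = 0 then 0 else c l (m - 1)) +
      c l m = if l = 0 ∧ m = 0 then 1 else 0 := by
    intro l m
    rcases l with _ | l <;> rcases m with _ | m
    · simp [c]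
    · simp [c, pow_succ]
    · simp [c, pow_succ]
    · have h : (l + 1 + (m + 1)).choose (m + 1) =
          (l + 1 + m).choose m + (l + (m + 1)).choose (m + 1) := by
        rw [show l + 1 + (m + 1) = (l + 1 + m) + 1 by ring, Nat.choose_succ_succ,
          show l + 1 + m = l + (m + 1) by ring]
      simp only [c, h, Nat.add_eq_zero_iff, one_ne_zero, and_false, if_false,
        add_tsub_cancel_right, Nat.cast_add]
      ring
  have : ∀ l m, c l m * (a (l + 1) * b m + a l * b (m + 1) + a l * b m) =
      c l m * (a (l + 1) * b m) + c l m * (a l * b (m + 1)) + c l m * (a l * b m) := by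
    intros; ring
  change ∑ l ∈ range (N + 1), ∑ m ∈ range (N + 1), c l m * _ = _
  simp_rw [this, sum_add_distrib]
  rw [e1, e2]
  simp_rw [← sum_add_distrib, ← add_mul, hrec]
  rw [sum_eq_single_of_mem 0 (by simp), sum_eq_single_of_mem 0 (by simp)]
  · simp
  · intro m _ hm; simp [hm]
  · intro l _ hl; simp [hl]

/-- The certificate matrix: minus the H-certificates off the diagonal. It is the solution of the
Stein equation `M S + Sᵀ M + M = N e_n e_nᵀ`, written as a series in the step matrix `S`. -/
noncomputable def certMatrix {n : ℕ} (H : Matrix (Fin n) (Fin n) ℝ) :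
    Matrix (Fin (n + 1)) (Fin (n + 1)) ℝ :=
  Matrix.of fun k j => ((n : ℝ) + 1) * ∑ l ∈ range (n + 1), ∑ m ∈ range (n + 1),
    (-1 : ℝ) ^ (l + m) * ((l + m).choose m : ℝ) *
      ((stepMatrix H ^ l) (Fin.last n) j * (stepMatrix H ^ m) (Fin.last n) k)

theorem certMatrix_symm {n : ℕ} (H : Matrix (Fin n) (Fin n) ℝ) (k j : Fin (n + 1)) :
    certMatrix H k j = certMatrix H j k := by
  simp only [certMatrix, Matrix.of_apply]
  rw [sum_comm]
  congr 1
  refine sum_congr rfl fun l _ => sum_congr rfl fun m _ => ?_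
  rw [add_comm m l, Nat.choose_symm_add]
  ring

theorem certMatrix_transpose {n : ℕ} (H : Matrix (Fin n) (Fin n) ℝ) :
    (certMatrix H).transpose = certMatrix H :=
  Matrix.ext fun k j => certMatrix_symm H j k

theorem certMatrix_stein {n : ℕ} (H : Matrix (Fin n) (Fin n) ℝ) :
    certMatrix H * stepMatrix H + (stepMatrix H).transpose * certMatrix H + certMatrix H =
      ((n : ℝ) + 1) • Matrix.single (Fin.last n) (Fin.last n) 1 := by
  ext k j
  have h := sum_neg_one_pow_choose_shift n (fun l => (stepMatrix H ^ l) (Fin.last n) j)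
    (fun l => (stepMatrix H ^ l) (Fin.last n) k) (by simp [stepMatrix_pow_card])
    (by simp [stepMatrix_pow_card])
  have e1 : (certMatrix H * stepMatrix H) k j = ((n : ℝ) + 1) * ∑ l ∈ range (n + 1),
      ∑ m ∈ range (n + 1), (-1 : ℝ) ^ (l + m) * ((l + m).choose m : ℝ) *
      ((stepMatrix H ^ (l + 1)) (Fin.last n) j * (stepMatrix H ^ m) (Fin.last n) k) := by
    simp_rw [Matrix.mul_apply, certMatrix, Matrix.of_apply, mul_assoc, ← mul_sum, sum_mul]
    rw [sum_comm]
    congr 1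
    refine sum_congr rfl fun l _ => ?_
    rw [sum_comm]
    refine sum_congr rfl fun m _ => ?_
    rw [pow_succ, Matrix.mul_apply, sum_mul, mul_sum, mul_sum]
    exact sum_congr rfl fun i _ => by ring
  have e2 : ((stepMatrix H).transpose * certMatrix H) k j = ((n : ℝ) + 1) *
      ∑ l ∈ range (n + 1), ∑ m ∈ range (n + 1), (-1 : ℝ) ^ (l + m) * ((l + m).choose m : ℝ) *
      ((stepMatrix H ^ l) (Fin.last n) j * (stepMatrix H ^ (m + 1)) (Fin.last n) k) := by
    simp_rw [Matrix.mul_apply, certMatrix, Matrix.of_apply, Matrix.transpose_apply,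
      mul_left_comm _ ((n : ℝ) + 1), ← mul_sum, mul_sum]
    rw [sum_comm]
    simp_rw [← mul_sum]
    congr 1
    refine sum_congr rfl fun l _ => ?_
    simp_rw [mul_sum]
    rw [sum_comm]
    refine sum_congr rfl fun m _ => ?_
    rw [pow_succ, Matrix.mul_apply, mul_sum, mul_sum]
    exact sum_congr rfl fun i _ => by ring
  rw [Matrix.add_apply, Matrix.add_apply, e1, e2, certMatrix, Matrix.of_apply, ← mul_add,
    ← mul_add, ← sum_add_distrib, ← sum_add_distrib]
  simp_rw [← sum_add_distrib, ← mul_add]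
  rw [h, Matrix.smul_apply, Matrix.single_apply, smul_eq_mul, pow_zero, Matrix.one_apply,
    Matrix.one_apply]
  congr 1
  by_cases hk : Fin.last n = k <;> by_cases hj : Fin.last n = j <;> simp [hk, hj]

theorem certMatrix_eq_neg_cert {n : ℕ} (H : Matrix (Fin n) (Fin n) ℝ) {k j : Fin (n + 1)}
    (hjk : j < k) : certMatrix H k j = -cert H (k + 1) (j + 1) := by
  have hj0 : (stepMatrix H ^ 0) (Fin.last n) j = 0 := by
    rw [pow_zero, Matrix.one_apply_ne]
    exact (lt_of_lt_of_le hjk (Fin.le_last k)).ne'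
  have hIcc : ∀ f : ℕ → ℝ, f 0 = 0 → ∑ l ∈ range (n + 1), f l = ∑ l ∈ Icc 1 n, f l := by
    intro f hf
    rw [range_eq_Ico, sum_eq_sum_Ico_succ_bot (by omega), hf, zero_add]
    rfl
  have hpow : ∀ l ∈ Icc 1 n, ∀ i, (stepMatrix H ^ l) (Fin.last n) i = Q H l (i + 1) := by
    intro l hl i
    obtain ⟨l, rfl⟩ := Nat.exists_eq_succ_of_ne_zero (show l ≠ 0 by have := mem_Icc.1 hl; omega)
    exact stepMatrix_pow_last H l i
  rw [certMatrix, Matrix.of_apply, hIcc _ (sum_eq_zero fun m _ => by rw [hj0]; ring), cert]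
  split_ifs with hk
  · obtain rfl : k = Fin.last n := Fin.ext (by simpa using hk)
    rw [← mul_neg, ← sum_neg_distrib]
    congr 1
    refine sum_congr rfl fun l hl => ?_
    rw [sum_eq_single_of_mem 0 (by simp), hpow l hl]
    · obtain ⟨l, rfl⟩ := Nat.exists_eq_succ_of_ne_zero (show l ≠ 0 by have := mem_Icc.1 hl; omega)
      simp [pow_succ]
    · intro m _ hm
      rw [strictLower_pow_eq_zero (fun _ _ h => stepMatrix_eq_zero H h) m (Fin.last n) (Fin.last n)
        (by simp; omega)]
      ring
  · have hk0 : (stepMatrix H ^ 0) (Fin.last n) k = 0 := by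
      rw [pow_zero, Matrix.one_apply_ne]
      rintro rfl; simp at hk
    rw [← mul_neg, ← sum_neg_distrib]
    congr 1
    refine sum_congr rfl fun l hl => ?_
    rw [hIcc _ (by rw [hk0]; ring), ← sum_neg_distrib]
    refine sum_congr rfl fun m hm => ?_
    rw [hpow l hl, hpow m hm]
    obtain ⟨l, rfl⟩ := Nat.exists_eq_succ_of_ne_zero (show l ≠ 0 by have := mem_Icc.1 hl; omega)
    rw [show l.succ + m - 1 = l + m by omega, show l.succ + m = l + m + 1 by omega, pow_succ]
    ring

/-! ### Quadratic forms of Gram matrices -/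

section Form

variable {V ι : Type*} [NormedAddCommGroup V] [InnerProductSpace ℝ V]

theorem sum_inner_sum_smul [Fintype ι] (P : Matrix ι ι ℝ) (S : Matrix ι ι ℝ) (g : ι → V) :
    ∑ k, inner ℝ (∑ l, P k l • g l) (∑ j, S k j • g j) =
      ∑ l, ∑ j, (P.transpose * S) l j * inner ℝ (g l) (g j) := by
  simp_rw [sum_inner, inner_sum, real_inner_smul_left, real_inner_smul_right, Matrix.mul_apply,
    Matrix.transpose_apply, sum_mul]
  rw [sum_comm]
  refine sum_congr rfl fun l _ => ?_
  rw [sum_comm]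
  exact sum_congr rfl fun j _ => sum_congr rfl fun k _ => by ring

/-- The Stein equation, read as an identity of quadratic forms in a family of vectors. -/
theorem sum_inner_certMatrix {n : ℕ} (H : Matrix (Fin n) (Fin n) ℝ) (g : Fin (n + 1) → V) :
    ∑ k, inner ℝ (∑ l, certMatrix H k l • g l)
      ((2 : ℝ) • ∑ j, stepMatrix H k j • g j + g k) =
      ((n : ℝ) + 1) * ‖g (Fin.last n)‖ ^ 2 := by
  have h1 := sum_inner_sum_smul (certMatrix H) (stepMatrix H) g
  have h2 := sum_inner_sum_smul (stepMatrix H) (certMatrix H) g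
  have h3 := sum_inner_sum_smul (certMatrix H) 1 g
  rw [Matrix.mul_one] at h3
  rw [certMatrix_transpose] at h1 h3
  have h4 : ∀ k, ∑ j, (1 : Matrix (Fin (n + 1)) (Fin (n + 1)) ℝ) k j • g j = g k := by
    intro k
    simp [Matrix.one_apply]
  simp_rw [h4] at h3
  have h5 : ∑ k, inner ℝ (∑ l, certMatrix H k l • g l) (∑ j, stepMatrix H k j • g j) =
      ∑ k, inner ℝ (∑ l, stepMatrix H k l • g l) (∑ j, certMatrix H k j • g j) :=
    sum_congr rfl fun k _ => real_inner_comm _ _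
  have h6 : ∑ l, ∑ j, (certMatrix H * stepMatrix H + (stepMatrix H).transpose * certMatrix H +
      certMatrix H) l j * inner ℝ (g l) (g j) = ((n : ℝ) + 1) * ‖g (Fin.last n)‖ ^ 2 := by
    rw [certMatrix_stein, sum_eq_single_of_mem (Fin.last n) (mem_univ _),
      sum_eq_single_of_mem (Fin.last n) (mem_univ _)]
    · simp
    · intro j _ hj; simp [hj.symm]
    · intro l _ hl
      exact sum_eq_zero fun j _ => by simp [hl.symm]
  simp_rw [Matrix.add_apply, add_mul, sum_add_distrib] at h6
  simp_rw [inner_add_right, real_inner_smul_right, sum_add_distrib, ← mul_sum]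
  linarith

/-- The bilinear form of a symmetric matrix, written as a sum over pairs of indices and a
diagonal part given by the row sums. -/
theorem sum_inner_eq_pairs_add_rowSum (A : Finset ι) (M : Matrix ι ι ℝ)
    (hM : ∀ k l, M k l = M l k) (g z : ι → V) :
    ∑ k ∈ A, inner ℝ (∑ l ∈ A, M k l • g l) (z k) =
      -(1 / 2) * ∑ k ∈ A, ∑ l ∈ A, M k l * inner ℝ (g k - g l) (z k - z l) +
        ∑ k ∈ A, (∑ l ∈ A, M k l) * inner ℝ (g k) (z k) := by
  have e : ∀ k l, M k l * inner ℝ (g k - g l) (z k - z l) =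
      M k l * inner ℝ (g k) (z k) + M k l * inner ℝ (g l) (z l) -
        M k l * inner ℝ (g k) (z l) - M k l * inner ℝ (g l) (z k) := by
    intro k l
    rw [inner_sub_left, inner_sub_right, inner_sub_right]; ring
  have s1 : ∑ k ∈ A, ∑ l ∈ A, M k l * inner ℝ (g l) (z l) =
      ∑ k ∈ A, ∑ l ∈ A, M k l * inner ℝ (g k) (z k) := by
    rw [sum_comm]
    exact sum_congr rfl fun k _ => sum_congr rfl fun l _ => by rw [hM]
  have s2 : ∑ k ∈ A, ∑ l ∈ A, M k l * inner ℝ (g k) (z l) =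
      ∑ k ∈ A, ∑ l ∈ A, M k l * inner ℝ (g l) (z k) := by
    rw [sum_comm]
    exact sum_congr rfl fun k _ => sum_congr rfl fun l _ => by rw [hM]
  simp_rw [e, sum_sub_distrib, sum_add_distrib]
  rw [s1, s2]
  simp_rw [sum_inner, real_inner_smul_left, sum_mul]
  ring

end Form

open Filter Topology

/-! ### Necessity of the certificate conditions -/

theorem iter_eq_sub_stepMatrix {X : Type*} [AddCommGroup X] [Module ℝ X] {n : ℕ}
    (H : Matrix (Fin n) (Fin n) ℝ) (T : X → X) (y₀ : X) (k : Fin (n + 1)) :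
    iter (ent H) T y₀ k = y₀ - ∑ j : Fin (n + 1), stepMatrix H k j • resid (ent H) T y₀ j := by
  rw [iter_eq_sub_sum]
  congr 1
  refine Eq.trans ?_ (sum_range (fun j => stepSum (ent H) k j • resid (ent H) T y₀ j))
  refine sum_subset (fun j hj => mem_range.2 ?_) fun j _ hj => ?_
  · have := mem_range.1 hj; omega
  · rw [stepSum_eq_zero _ (by simpa using hj), zero_smul]

/-- An operator that takes the prescribed values at the candidate iterates has the candidates as
its iterates and the prescribed residuals. -/
theorem resid_eq_of_interpolation {X : Type*} [AddCommGroup X] [Module ℝ X] {n : ℕ}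
    (H : Matrix (Fin n) (Fin n) ℝ) (T : X → X) (u : X) (g : Fin (n + 1) → X)
    (hT : ∀ k, T (u - ∑ j, stepMatrix H k j • g j) = u - ∑ j, stepMatrix H k j • g j - g k)
    (k : Fin (n + 1)) : resid (ent H) T u k = g k := by
  obtain ⟨k, hk⟩ := k
  induction k using Nat.strong_induction_on with
  | _ k ih =>
    have h1 : iter (ent H) T u k = u - ∑ j, stepMatrix H ⟨k, hk⟩ j • g j := by
      refine (iter_eq_sub_stepMatrix H T u ⟨k, hk⟩).trans ?_
      congr 1
      refine sum_congr rfl fun j _ => ?_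
      rcases lt_or_ge j ⟨k, hk⟩ with hjk | hkj
      · rw [ih j hjk j.2]
      · rw [stepMatrix_eq_zero H hkj, zero_smul, zero_smul]
    change iter (ent H) T u k - T (iter (ent H) T u k) = _
    rw [h1, hT, sub_sub_cancel]

/-- Solvability of the Stein equation: left multiplication by `S` and right multiplication by `Sᵀ`
are commuting nilpotent operators. -/
theorem exists_stein_solution {n : ℕ} {S : Matrix (Fin n) (Fin n) ℝ} (hS : IsNilpotent S)
    (R : Matrix (Fin n) (Fin n) ℝ) (hR : R.transpose = R) :
    ∃ G : Matrix (Fin n) (Fin n) ℝ, G.transpose = G ∧ S * G + G * S.transpose + G = R := by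
  have hSt : IsNilpotent S.transpose := by
    obtain ⟨m, hm⟩ := hS
    exact ⟨m, by rw [← Matrix.transpose_pow, hm, Matrix.transpose_zero]⟩
  have h1 : IsNilpotent (LinearMap.mulLeft ℝ S + LinearMap.mulRight ℝ S.transpose) :=
    (LinearMap.commute_mulLeft_right S S.transpose).isNilpotent_add
      ((LinearMap.isNilpotent_mulLeft_iff ℝ S).2 hS)
      ((LinearMap.isNilpotent_mulRight_iff ℝ S.transpose).2 hSt)
  obtain ⟨G, hG⟩ := ((Module.End.isUnit_iff _).1 h1.isUnit_one_add).2 R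
  have hG' : S * G + G * S.transpose + G = R := by
    rw [← hG]
    simp only [LinearMap.add_apply, Module.End.one_apply, LinearMap.mulLeft_apply,
      LinearMap.mulRight_apply]
    abel
  have hG'' := congrArg Matrix.transpose hG'
  simp only [Matrix.transpose_add, Matrix.transpose_mul, Matrix.transpose_transpose, hR] at hG''
  -- the symmetric part of a solution is a solution
  refine ⟨(1 / 2 : ℝ) • (G + G.transpose), ?_, ?_⟩
  · rw [Matrix.transpose_smul, Matrix.transpose_add, Matrix.transpose_transpose, add_comm]
  · calc _ = (1 / 2 : ℝ) • ((S * G + G * S.transpose + G) +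
          (S * G.transpose + G.transpose * S.transpose + G.transpose)) := by
          simp only [Matrix.mul_smul, Matrix.smul_mul, Matrix.mul_add, Matrix.add_mul, smul_add]
          abel
      _ = (1 / 2 : ℝ) • (R + R) := by
          congr 2
          rw [add_comm (S * G.transpose)]
          exact hG''
      _ = R := by rw [← two_smul ℝ R, smul_smul]; norm_num

section Perturbation

variable {V : Type*} [NormedAddCommGroup V] [InnerProductSpace ℝ V]

theorem eventually_quadratic_pos {a : ℝ} (ha : 0 < a) (b : ℝ) :
    ∀ᶠ ε in 𝓝[>] (0 : ℝ), 0 < ε * a + ε ^ 2 * b := by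
  have h1 : Tendsto (fun ε : ℝ => a + ε * b) (𝓝[>] 0) (𝓝 (a + 0 * b)) :=
    ((by fun_prop : Continuous fun ε : ℝ => a + ε * b).tendsto 0).mono_left nhdsWithin_le_nhds
  rw [zero_mul, add_zero] at h1
  filter_upwards [h1.eventually_const_lt ha, self_mem_nhdsWithin] with ε h2 h3
  have : 0 < ε * (a + ε * b) := mul_pos h3 h2
  linarith

theorem eventually_norm_sub_le (d e d' e' : V) (h₀ : 2 * inner ℝ d e = ‖e‖ ^ 2)
    (h₁ : 0 < inner ℝ d e' + inner ℝ d' e - inner ℝ e e') :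
    ∀ᶠ ε in 𝓝[>] (0 : ℝ), ‖(d + ε • d') - (e + ε • e')‖ ≤ ‖d + ε • d'‖ := by
  filter_upwards [eventually_quadratic_pos
    (a := 2 * (inner ℝ d e' + inner ℝ d' e - inner ℝ e e')) (by linarith)
    (2 * inner ℝ d' e' - ‖e'‖ ^ 2)] with ε hε
  refine le_of_sq_le_sq ?_ (norm_nonneg _)
  have h2 : ‖e + ε • e'‖ ^ 2 = ‖e‖ ^ 2 + 2 * (ε * inner ℝ e e') + ε ^ 2 * ‖e'‖ ^ 2 := by
    rw [norm_add_sq_real, real_inner_smul_right, norm_smul, mul_pow, Real.norm_eq_abs, sq_abs]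
  rw [norm_sub_sq_real, h2]
  simp only [inner_add_left, inner_add_right, real_inner_smul_left, real_inner_smul_right]
  nlinarith

theorem eventually_norm_sq_lt (u r g g' : V) (c : ℝ) (h₀ : ‖u‖ ^ 2 = c * ‖g‖ ^ 2)
    (h₁ : inner ℝ u r < c * inner ℝ g g') :
    ∀ᶠ ε in 𝓝[>] (0 : ℝ), ‖u + ε • r‖ ^ 2 < c * ‖g + ε • g'‖ ^ 2 := by
  filter_upwards [eventually_quadratic_pos
    (a := 2 * (c * inner ℝ g g' - inner ℝ u r)) (by linarith)
    (c * ‖g'‖ ^ 2 - ‖r‖ ^ 2)] with ε hε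
  have h : ∀ v v' : V, ‖v + ε • v'‖ ^ 2 =
      ‖v‖ ^ 2 + 2 * (ε * inner ℝ v v') + ε ^ 2 * ‖v'‖ ^ 2 := by
    intro v v'
    rw [norm_add_sq_real, real_inner_smul_right, norm_smul, mul_pow, Real.norm_eq_abs, sq_abs]
  rw [h, h]
  nlinarith

end Perturbation

/-- First-order perturbation of the worst-case instance: the residuals move along `g'`, the starting
point along `r`. If every interpolation inequality acquires a positive derivative, then for small
`ε` the perturbed data extend to a nonexpansive operator by Kirszbraun's theorem, so optimality
bounds the derivative of `N² ‖g_n‖² / 4 - ‖y₀ - y⋆‖²`. -/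
theorem le_two_mul_of_mem_optimalSet {n : ℕ} {H : Matrix (Fin n) (Fin n) ℝ}
    (hH : H ∈ optimalSet n) (G K : Matrix (Fin (n + 1)) (Fin (n + 1)) ℝ) (v : Fin (n + 1) → ℝ)
    (hG : G.transpose = G)
    (hK : ∀ k l, (stepMatrix H * G + G * (stepMatrix H).transpose + G) k l = v k + v l - K k l)
    (hKd : ∀ k, 0 < K k k) (hKp : ∀ k l, k ≠ l → 0 < K k k + K l l - 2 * K k l) :
    ((n : ℝ) + 1) * G (Fin.last n) (Fin.last n) ≤ 2 * v (Fin.last n) := by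
  by_contra! hlt
  have hN : (0 : ℝ) < (n : ℝ) + 1 := by positivity
  have hGs : ∀ k l, G k l = G l k := fun k l => congrFun (congrFun hG l) k
  set S := stepMatrix H with hS
  set u := onesVec n with hu
  let g : Fin (n + 1) → EuclideanSpace ℝ (Fin (n + 1)) := fun k =>
    resid (ent H) (negShift n) u k
  have hgn : g (Fin.last n) = (2 / ((n : ℝ) + 1)) • u := resid_negShift_of_mem_optimalSet hH
  have hgn0 : resid (ent H) (negShift n) (onesVec n) n (Fin.last n) ≠ 0 := by
    rw [resid_negShift_of_mem_optimalSet hH]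
    simp [onesVec, hN.ne']
  have hsol := exists_inner_resid_negShift (ent H) hgn0
  choose g' hg' using fun k => hsol fun l => G k l / 2
  obtain ⟨r, hr⟩ := hsol fun l => v l - inner ℝ u (g' l)
  have hg1 : ∀ k l, inner ℝ (g l) (g' k) = G k l / 2 := hg'
  have hr1 : ∀ l, inner ℝ (g l) r = v l - inner ℝ u (g' l) := hr
  let y : Fin (n + 1) → EuclideanSpace ℝ (Fin (n + 1)) := fun k => u - ∑ j, S k j • g j
  let y' : Fin (n + 1) → EuclideanSpace ℝ (Fin (n + 1)) := fun k => r - ∑ j, S k j • g' j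
  have hy : ∀ k, y k = iter (ent H) (negShift n) u k := fun k =>
    (iter_eq_sub_stepMatrix H (negShift n) u k).symm
  have hgy : ∀ k, g k = y k - negShift n (y k) := fun k => by rw [hy]; rfl
  -- the derivative of the polarised interpolation form
  have hb : ∀ k l, inner ℝ (y k) (g' l) + inner ℝ (y' k) (g l) -
      (inner ℝ (g k) (g' l) + inner ℝ (g' k) (g l)) / 2 = v l - (S * G) k l - G k l / 2 := by
    intro k l
    have e1 : inner ℝ (y k) (g' l) = inner ℝ u (g' l) - (S * G) k l / 2 := by
      simp only [y, inner_sub_left, sum_inner, real_inner_smul_left, hg1, Matrix.mul_apply, sum_div]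
      congr 1
      exact sum_congr rfl fun j _ => by rw [hGs]; ring
    have e2 : inner ℝ (y' k) (g l) = v l - inner ℝ u (g' l) - (S * G) k l / 2 := by
      have : ∀ j, inner ℝ (g' j) (g l) = G j l / 2 := fun j => by rw [real_inner_comm, hg1]
      simp only [y', inner_sub_left, sum_inner, real_inner_smul_left, this, Matrix.mul_apply,
        sum_div]
      rw [real_inner_comm, hr1]
      congr 1
      exact sum_congr rfl fun j _ => by ring
    rw [e1, e2, hg1 l k, real_inner_comm (g l) (g' k), hg1 k l, hGs l k]
    ring
  have hbK : ∀ k l, (v l - (S * G) k l - G k l / 2) + (v k - (S * G) l k - G l k / 2) = K k l := by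
    intro k l
    have h1 := hK k l
    have h2 : (G * S.transpose) k l = (S * G) l k := by
      rw [Matrix.mul_apply, Matrix.mul_apply]
      exact sum_congr rfl fun j _ => by rw [Matrix.transpose_apply, hGs]; ring
    rw [Matrix.add_apply, Matrix.add_apply, h2] at h1
    rw [hGs l k]
    linarith
  have hev1 : ∀ k l, ∀ᶠ ε in 𝓝[>] (0 : ℝ),
      ‖(y k - y l + ε • (y' k - y' l)) - (g k - g l + ε • (g' k - g' l))‖ ≤
        ‖y k - y l + ε • (y' k - y' l)‖ := by
    intro k l
    rcases eq_or_ne k l with rfl | hkl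
    · simp
    refine eventually_norm_sub_le _ _ _ _ ?_ ?_
    · have : g k - g l = (y k - y l) - negShift n (y k - y l) := by
        rw [← negShift_sub, hgy k, hgy l, sub_sub_sub_comm]
      rw [this]
      exact inner_sub_negShift _
    · have h1 := hKp k l hkl
      rw [← hbK k k, ← hbK l l, ← hbK k l, ← hb k k, ← hb l l, ← hb k l, ← hb l k] at h1
      simp only [inner_sub_left, inner_sub_right]
      have c1 := real_inner_comm (g' k) (g k)
      have c2 := real_inner_comm (g' k) (g l)
      have c3 := real_inner_comm (g' l) (g k)
      have c4 := real_inner_comm (g' l) (g l)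
      linarith
  have hev2 : ∀ k, ∀ᶠ ε in 𝓝[>] (0 : ℝ),
      ‖(y k + ε • y' k) - (g k + ε • g' k)‖ ≤ ‖y k + ε • y' k‖ := by
    intro k
    refine eventually_norm_sub_le _ _ _ _ ?_ ?_
    · rw [hgy]; exact inner_sub_negShift _
    · have h1 := hKd k
      rw [← hbK k k, ← hb k k] at h1
      have c1 := real_inner_comm (g' k) (g k)
      linarith
  have hev3 : ∀ᶠ ε in 𝓝[>] (0 : ℝ), ‖u + ε • r‖ ^ 2 <
      (((n : ℝ) + 1) ^ 2 / 4) * ‖g (Fin.last n) + ε • g' (Fin.last n)‖ ^ 2 := by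
    have hug : u = (((n : ℝ) + 1) / 2) • g (Fin.last n) := by
      rw [hgn, smul_smul]
      have : ((n : ℝ) + 1) / 2 * (2 / ((n : ℝ) + 1)) = 1 := by field_simp
      rw [this, one_smul]
    refine eventually_norm_sq_lt _ _ _ _ _ ?_ ?_
    · conv_lhs => rw [hug]
      rw [norm_smul, mul_pow, Real.norm_eq_abs, sq_abs]
      ring
    · have h1 := hr1 (Fin.last n)
      rw [hug, real_inner_smul_left, hg1] at h1
      rw [hug, real_inner_smul_left, h1, hg1]
      nlinarith
  obtain ⟨ε, ⟨h1, h2⟩, h3⟩ :=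
    (((eventually_all.2 fun k => eventually_all.2 fun l => hev1 k l).and
      (eventually_all.2 hev2)).and hev3).exists
  -- the perturbed instance
  have hyε : ∀ k, u + ε • r - ∑ j, S k j • (g j + ε • g' j) = y k + ε • y' k := by
    intro k
    simp only [y, y', smul_add, smul_sub, sum_add_distrib, smul_sum, smul_comm ε]
    abel
  obtain ⟨T, hT, hTG⟩ := exists_lipschitzWith_one_extension
    (insert 0 (Set.range fun k => (y k + ε • y' k, (y k + ε • y' k) - (g k + ε • g' k)))) (by
      rintro p (rfl | ⟨k, rfl⟩) q (rfl | ⟨l, rfl⟩)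
      · simp
      · simpa only [Prod.fst_zero, Prod.snd_zero, zero_sub, norm_neg] using h2 l
      · simpa only [Prod.fst_zero, Prod.snd_zero, sub_zero] using h2 k
      · have e : ∀ a a' b b' : EuclideanSpace ℝ (Fin (n + 1)),
            (a + ε • a') - (b + ε • b') = a - b + ε • (a' - b') := fun a a' b b' => by
          rw [add_sub_add_comm, smul_sub]
        change ‖_ - _‖ ≤ ‖(y k + ε • y' k) - (y l + ε • y' l)‖
        rw [sub_sub_sub_comm, e, e]
        exact h1 k l)
  have hT0 : T 0 = 0 := hTG 0 (Set.mem_insert _ _)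
  have hTy : ∀ k, T (y k + ε • y' k) = (y k + ε • y' k) - (g k + ε • g' k) := fun k =>
    hTG _ (Set.mem_insert_of_mem _ ⟨k, rfl⟩)
  have hres := resid_eq_of_interpolation H T (u + ε • r) (fun k => g k + ε • g' k)
    (fun k => by rw [hyε, hTy]) (Fin.last n)
  have hopt := hH.2 _ T hT (u + ε • r) 0 hT0
  change ‖resid (ent H) T (u + ε • r) (Fin.last n)‖ ^ 2 ≤ _ at hopt
  rw [hres, sub_zero, le_div_iff₀ (by positivity)] at hopt
  linarith

/-- The certificate conditions are necessary for optimality: the certificate matrix has row sums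
`e_n` and nonpositive off-diagonal entries. -/
theorem certMatrix_of_mem_optimalSet {n : ℕ} {H : Matrix (Fin n) (Fin n) ℝ}
    (hH : H ∈ optimalSet n) :
    (∀ k, ∑ j, certMatrix H k j = if k = Fin.last n then 1 else 0) ∧
      ∀ k j, k ≠ j → certMatrix H k j ≤ 0 := by
  set M := certMatrix H with hM
  have hMs : ∀ k j, M k j = M j k := certMatrix_symm H
  have key : ∀ (K : Matrix (Fin (n + 1)) (Fin (n + 1)) ℝ) (v : Fin (n + 1) → ℝ),
      (∀ k l, K k l = K l k) → (∀ k, 0 < K k k) →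
      (∀ k l, k ≠ l → 0 < K k k + K l l - 2 * K k l) →
      2 * ∑ k, (∑ j, M k j - if k = Fin.last n then 1 else 0) * v k ≤
        ∑ k, ∑ l, M k l * K k l := by
    intro K v hKs hKd hKp
    obtain ⟨G, hG, hGR⟩ := exists_stein_solution ⟨n + 1, stepMatrix_pow_card H⟩
      (Matrix.of fun k l => v k + v l - K k l)
      (by ext k l; simp only [Matrix.transpose_apply, Matrix.of_apply, hKs k l]; ring)
    have h1 := le_two_mul_of_mem_optimalSet hH G K v hG (fun k l => by rw [hGR]; rfl) hKd hKp
    have h2 : Matrix.trace (M * (stepMatrix H * G + G * (stepMatrix H).transpose + G)) =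
        Matrix.trace ((((n : ℝ) + 1) • Matrix.single (Fin.last n) (Fin.last n) 1) * G) := by
      rw [← certMatrix_stein, Matrix.mul_add, Matrix.mul_add, Matrix.add_mul, Matrix.add_mul,
        Matrix.trace_add, Matrix.trace_add, Matrix.trace_add, Matrix.trace_add, ← hM,
        ← Matrix.mul_assoc M G, Matrix.trace_mul_comm (M * G), Matrix.mul_assoc, Matrix.mul_assoc]
    rw [hGR, Matrix.smul_mul, Matrix.trace_smul, Matrix.trace_single_mul, one_smul,
      smul_eq_mul] at h2
    have h3 : Matrix.trace (M * Matrix.of fun k l => v k + v l - K k l) =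
        2 * ∑ k, (∑ j, M k j) * v k - ∑ k, ∑ l, M k l * K k l := by
      have e1 : ∑ k, ∑ l, M k l * v l = ∑ k, (∑ j, M k j) * v k := by
        rw [sum_comm]
        refine sum_congr rfl fun k _ => ?_
        rw [sum_mul]
        exact sum_congr rfl fun l _ => by rw [hMs]
      have e2 : ∑ k, ∑ l, M k l * v k = ∑ k, (∑ j, M k j) * v k :=
        sum_congr rfl fun k _ => by rw [sum_mul]
      have e3 : ∀ k l, M k l * (v l + v k - K l k) = M k l * v l + M k l * v k - M k l * K k l := by
        intro k l; rw [hKs]; ring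
      simp only [Matrix.trace, Matrix.diag_apply, Matrix.mul_apply, Matrix.of_apply]
      simp_rw [e3, sum_sub_distrib, sum_add_distrib]
      rw [e1, e2]; ring
    rw [h3] at h2
    simp_rw [sub_mul, sum_sub_distrib]
    simp only [ite_mul, one_mul, zero_mul, sum_ite_eq', mem_univ, if_true]
    linarith
  have hone : ∀ ε : ℝ, 0 < ε → ∀ v : Fin (n + 1) → ℝ,
      2 * ∑ k, (∑ j, M k j - if k = Fin.last n then 1 else 0) * v k ≤ ε * ∑ k, M k k := by
    intro ε hε v
    have := key (Matrix.diagonal fun _ => ε) v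
      (fun k l => by simp [Matrix.diagonal_apply, eq_comm])
      (fun k => by simpa using hε) (fun k l hkl => by simp [Matrix.diagonal_apply_ne _ hkl]; linarith)
    refine this.trans (le_of_eq ?_)
    simp [Matrix.diagonal_apply, mul_sum, mul_comm]
  refine ⟨fun k => ?_, fun a b hab => ?_⟩
  -- take `v` a large multiple of the defect `w` of the row sums
  · set w : Fin (n + 1) → ℝ := fun k => ∑ j, M k j - if k = Fin.last n then 1 else 0 with hw
    have h0 : ∑ k, w k * w k ≤ 0 := by
      by_contra! hpos
      obtain ⟨s, hs⟩ := exists_nat_gt ((∑ k, M k k) / (2 * ∑ k, w k * w k))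
      have h1 := hone 1 one_pos fun k => (s : ℝ) * w k
      have h2 : ∑ k, w k * ((s : ℝ) * w k) = s * ∑ k, w k * w k := by
        rw [mul_sum]; exact sum_congr rfl fun k _ => by ring
      rw [div_lt_iff₀ (by linarith)] at hs
      change 2 * ∑ k, w k * ((s : ℝ) * w k) ≤ _ at h1
      rw [h2] at h1
      linarith
    have h1 := (sum_eq_zero_iff_of_nonneg fun k _ => mul_self_nonneg (w k)).1
      (le_antisymm h0 (sum_nonneg fun k _ => mul_self_nonneg (w k))) k (mem_univ k)
    exact sub_eq_zero.1 (mul_self_eq_zero.1 h1)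
  · refine le_of_forall_pos_le_add fun δ hδ => ?_
    -- as `ε → 0`, the perturbation `K = ε - P` tests the entries `(a, b)` and `(b, a)` only
    have hex : ∃ ε : ℝ, 0 < ε ∧ ε * ∑ k, M k k ≤ 2 * δ := by
      refine ⟨2 * δ / (|∑ k, M k k| + 1), by positivity, ?_⟩
      rw [div_mul_eq_mul_div, div_le_iff₀ (by positivity)]
      have := le_abs_self (∑ k, M k k)
      nlinarith
    obtain ⟨ε, hε, hεδ⟩ := hex
    let P : Matrix (Fin (n + 1)) (Fin (n + 1)) ℝ := Matrix.single a b 1 + Matrix.single b a 1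
    have hPs : ∀ k l, P k l = P l k := by
      intro k l
      simp only [P, Matrix.add_apply, Matrix.single_apply]
      rw [add_comm]
      congr 2 <;> exact propext and_comm
    have hPd : ∀ k, P k k = 0 := by
      intro k
      simp only [P, Matrix.add_apply, Matrix.single_apply]
      rw [if_neg, if_neg, add_zero]
      · rintro ⟨rfl, h⟩; exact hab h
      · rintro ⟨rfl, h⟩; exact hab h.symm
    have hP0 : ∀ k l, 0 ≤ P k l := by
      intro k l
      simp only [P, Matrix.add_apply, Matrix.single_apply]
      split_ifs <;> norm_num
    have hMP : ∑ k, ∑ l, M k l * P k l = 2 * M a b := by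
      have e : ∀ a b : Fin (n + 1), ∑ k, ∑ l, M k l * (Matrix.single a b (1 : ℝ)) k l = M a b := by
        intro a b
        rw [sum_eq_single_of_mem a (mem_univ _), sum_eq_single_of_mem b (mem_univ _)]
        · simp
        · intro l _ hl; simp [hl.symm]
        · intro k _ hk
          exact sum_eq_zero fun l _ => by simp [hk.symm]
      simp_rw [P, Matrix.add_apply, mul_add, sum_add_distrib]
      rw [e, e, hMs b a]; ring
    have h1 := key (Matrix.diagonal (fun _ => ε) - P) 0
      (fun k l => by
        rw [Matrix.sub_apply, Matrix.sub_apply, hPs]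
        simp [Matrix.diagonal_apply, eq_comm])
      (fun k => by rw [Matrix.sub_apply, hPd]; simpa using hε)
      (fun k l hkl => by
        simp only [Matrix.sub_apply, hPd, Matrix.diagonal_apply_eq, Matrix.diagonal_apply_ne _ hkl]
        linarith [hP0 k l])
    simp only [Matrix.sub_apply, mul_sub, sum_sub_distrib, hMP, Pi.zero_apply, mul_zero,
      sum_const_zero, Matrix.diagonal_apply, mul_ite, sum_ite_eq, mem_univ, if_true,
      ← sum_mul] at h1
    linarith

/-! ### Rates from the certificate inequality -/

section Rate

variable {X : Type*} [NormedAddCommGroup X] [InnerProductSpace ℝ X]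

/-- Nonexpansiveness of `T`, written for the residual operator. -/
theorem norm_sq_sub_le_two_mul_inner {T : X → X} (hT : LipschitzWith 1 T) (x y : X) :
    ‖(x - T x) - (y - T y)‖ ^ 2 ≤ 2 * inner ℝ (x - y) ((x - T x) - (y - T y)) := by
  have h1 := hT.dist_le_mul x y
  rw [dist_eq_norm, dist_eq_norm, NNReal.coe_one, one_mul] at h1
  have h2 := norm_sub_sq_real (x - y) ((x - T x) - (y - T y))
  rw [show (x - y) - ((x - T x) - (y - T y)) = T x - T y by abel] at h2
  have h3 := pow_le_pow_left₀ (norm_nonneg _) h1 2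
  linarith

/-- The certificate inequality `⟨g_n, 2 (y₀ - y_n) + g_n⟩ ≥ N ‖g_n‖²` for the last residual `g_n`
of `n` steps, `N = n + 1`, of the method with step sizes `h` on the space `X`. -/
def Certified (X : Type*) [NormedAddCommGroup X] [InnerProductSpace ℝ X] (h : ℕ → ℕ → ℝ) (n : ℕ) :
    Prop :=
  ∀ (T : X → X), LipschitzWith 1 T → ∀ y₀ : X, ((n : ℝ) + 1) * ‖resid h T y₀ n‖ ^ 2 ≤
    inner ℝ (resid h T y₀ n) ((2 : ℝ) • (y₀ - iter h T y₀ n) + resid h T y₀ n)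

theorem Certified.rate {h : ℕ → ℕ → ℝ} {n : ℕ} (hC : Certified X h n) {T : X → X}
    (hT : LipschitzWith 1 T) (y₀ : X) {yStar : X} (hfix : T yStar = yStar) :
    ‖iter h T y₀ n - T (iter h T y₀ n)‖ ^ 2 ≤ 4 * ‖y₀ - yStar‖ ^ 2 / ((n : ℝ) + 1) ^ 2 := by
  have h1 := hC T hT y₀
  have h2 := norm_sq_sub_le_two_mul_inner hT (iter h T y₀ n) yStar
  rw [hfix, sub_self, sub_zero] at h2
  change ‖resid h T y₀ n‖ ^ 2 ≤ _
  change ‖resid h T y₀ n‖ ^ 2 ≤ 2 * inner ℝ _ (resid h T y₀ n) at h2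
  set g := resid h T y₀ n
  set y := iter h T y₀ n
  have h3 : inner ℝ g ((2 : ℝ) • (y₀ - y) + g) + 2 * inner ℝ (y - yStar) g =
      2 * inner ℝ (y₀ - yStar) g + ‖g‖ ^ 2 := by
    rw [inner_add_right, real_inner_smul_right, real_inner_self_eq_norm_sq, real_inner_comm,
      show y₀ - yStar = (y₀ - y) + (y - yStar) by abel, inner_add_left]
    ring
  have h4 : inner ℝ (y₀ - yStar) g ≤ ‖y₀ - yStar‖ * ‖g‖ := real_inner_le_norm _ _
  have h5 : ((n : ℝ) + 1) * ‖g‖ ^ 2 ≤ 2 * (‖y₀ - yStar‖ * ‖g‖) := by linarith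
  have h6 : ((n : ℝ) + 1) * ‖g‖ ≤ 2 * ‖y₀ - yStar‖ := by
    rcases (norm_nonneg g).eq_or_lt with h0 | h0
    · rw [← h0, mul_zero]; positivity
    · refine le_of_mul_le_mul_right ?_ h0
      linarith
  rw [le_div_iff₀ (by positivity)]
  have := pow_le_pow_left₀ (by positivity) h6 2
  linarith

end Rate

/-! ### Initial blocks of decomposable optimal methods -/

/-- Step sizes with both indices shifted, so that the iterations from `a + 1` on are started
afresh. -/
theorem stepSum_shift (h : ℕ → ℕ → ℝ) (c s t : ℕ) :
    stepSum h (c + s) (c + t) = stepSum (fun i j => h (c + i) (c + j)) s t := by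
  rw [stepSum, stepSum, add_assoc, ← image_add_left_Icc, sum_image (by simp)]

/-- The data of a decomposable optimal method: the certificate matrix couples the indices `≤ a`
to the indices `> a` through the single entry `-c` at `(n, a)`. -/
theorem certMatrix_block {n a : ℕ} {H : Matrix (Fin n) (Fin n) ℝ}
    (hd : DecomposableAt H (a + 1)) :
    0 < cert H (n + 1) (a + 1) ∧ ∀ k j : Fin (n + 1), a < k → j ≤ a →
      certMatrix H k j =
        if k = Fin.last n ∧ (j : ℕ) = a then -cert H (n + 1) (a + 1) else 0 := by
  obtain ⟨⟨h1, h2⟩, h3⟩ := hd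
  refine ⟨h1, fun k j hk hj => ?_⟩
  have hkn : (k : ℕ) ≤ n := by omega
  rw [certMatrix_eq_neg_cert H (show j < k from Fin.lt_def.2 (by omega))]
  split_ifs with h
  · rw [h.1, h.2]; rfl
  · rw [neg_eq_zero]
    rcases hj.eq_or_lt with hja | hja
    · rw [hja]
      refine h2 _ (by omega) ?_
      by_contra hlt
      exact h ⟨Fin.ext (by rw [Fin.val_last]; omega), hja⟩
    · exact h3 _ _ (by omega) (by omega) (by omega) (by omega)

section Block

variable {n a : ℕ} {H : Matrix (Fin n) (Fin n) ℝ} {c : ℝ}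

theorem certMatrix_rowSum_right (hrow : ∀ k, ∑ j, certMatrix H k j = if k = Fin.last n then 1 else 0)
    (hAB : ∀ k j : Fin (n + 1), a < k → j ≤ a →
      certMatrix H k j = if k = Fin.last n ∧ (j : ℕ) = a then -c else 0) (han : a < n)
    (k : Fin (n + 1)) :
    ∑ l with a < ((l : Fin (n + 1)) : ℕ), certMatrix H k l =
      if a < (k : ℕ) then (if k = Fin.last n then 1 + c else 0)
        else (if (k : ℕ) = a then -c else 0) := by
  split_ifs with h1 h2 h2
  · have h3 := sum_filter_add_sum_filter_not univ (fun l : Fin (n + 1) => a < (l : ℕ))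
      (certMatrix H k)
    have h4 : ∑ l with ¬a < ((l : Fin (n + 1)) : ℕ), certMatrix H k l = -c := by
      rw [sum_eq_single_of_mem (⟨a, by omega⟩ : Fin (n + 1)) (by simp)]
      · rw [hAB _ _ h1 le_rfl, if_pos ⟨h2, rfl⟩]
      · intro l hl hla
        rw [hAB _ _ h1 (by simpa using hl), if_neg]
        rintro ⟨-, h⟩
        exact hla (Fin.ext h)
    rw [hrow, if_pos h2, h4] at h3
    linarith
  · have h3 := sum_filter_add_sum_filter_not univ (fun l : Fin (n + 1) => a < (l : ℕ))
      (certMatrix H k)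
    have h4 : ∑ l with ¬a < ((l : Fin (n + 1)) : ℕ), certMatrix H k l = 0 :=
      sum_eq_zero fun l hl => by
        rw [hAB _ _ h1 (by simpa using hl), if_neg fun h => h2 h.1]
    rw [hrow, if_neg h2, h4] at h3
    linarith
  · rw [sum_eq_single_of_mem (Fin.last n) (by simpa using han)]
    · rw [certMatrix_symm, hAB _ _ (by simpa using han) h2.le, if_pos ⟨rfl, h2⟩]
    · intro l hl hln
      rw [certMatrix_symm, hAB _ _ (by simpa using hl) h2.le, if_neg fun h => hln h.1]
  · refine sum_eq_zero fun l hl => ?_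
    rw [certMatrix_symm, hAB _ _ (by simpa using hl) (by omega), if_neg fun h => h2 h.2]

/-- A lower bound for the coupling: the block of indices `> a`, run on its own worst-case instance
of dimension `N - N'`, cannot beat the worst-case bound. -/
theorem coupling_lower_bound
    (hrow : ∀ k, ∑ j, certMatrix H k j = if k = Fin.last n then 1 else 0)
    (hAB : ∀ k j : Fin (n + 1), a < k → j ≤ a →
      certMatrix H k j = if k = Fin.last n ∧ (j : ℕ) = a then -c else 0) (han : a < n) :
    ((n : ℝ) + 1) ≤ (1 + c) * ((n : ℝ) - a) := by
  obtain ⟨b, rfl⟩ := Nat.exists_eq_add_of_lt han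
  let h' : ℕ → ℕ → ℝ := fun i j => ent H (a + 1 + i) (a + 1 + j)
  let u := onesVec b
  let T := negShift b
  let gN : ℕ → EuclideanSpace ℝ (Fin (b + 1)) := fun k => if a < k then resid h' T u (k - (a + 1))
    else 0
  let g : Fin (a + b + 1 + 1) → EuclideanSpace ℝ (Fin (b + 1)) := fun k => gN k
  let z : Fin (a + b + 1 + 1) → EuclideanSpace ℝ (Fin (b + 1)) := fun k =>
    (2 : ℝ) • (u - iter h' T u (k - (a + 1))) + g k
  have hz0 : ∀ k : Fin (a + b + 1 + 1), ¬a < (k : ℕ) →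
      (2 : ℝ) • ∑ j, stepMatrix H k j • g j + g k = 0 := by
    intro k hk
    have e1 : g k = 0 := if_neg hk
    rw [e1, sum_eq_zero, smul_zero, add_zero]
    intro j _
    rcases le_or_gt k j with hkj | hjk
    · rw [stepMatrix_eq_zero H hkj, zero_smul]
    · have e2 : g j = 0 := if_neg (by have : (j : ℕ) < k := hjk; omega)
      rw [e2, smul_zero]
  have hz : ∀ k : Fin (a + b + 1 + 1), a < (k : ℕ) →
      (2 : ℝ) • ∑ j, stepMatrix H k j • g j + g k = z k := by
    intro k hk
    obtain ⟨s, hs⟩ := Nat.exists_eq_add_of_lt hk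
    have hsb : s ≤ b := by omega
    have e1 : ∑ j, stepMatrix H k j • g j =
        ∑ j ∈ range (a + 1 + (b + 1)), stepSum (ent H) k j • gN j := by
      rw [show a + 1 + (b + 1) = a + b + 1 + 1 by omega]
      exact (sum_range fun j => stepSum (ent H) k j • gN j).symm
    have e2 : ∑ j ∈ range (a + 1), stepSum (ent H) k j • gN j = 0 :=
      sum_eq_zero fun j hj => by
        have := mem_range.1 hj
        rw [show gN j = 0 from if_neg (by omega), smul_zero]
    have e3 : ∑ t ∈ range (b + 1), stepSum (ent H) k (a + 1 + t) • gN (a + 1 + t) =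
        ∑ t ∈ range s, stepSum h' s t • resid h' T u t := by
      refine Eq.trans (sum_congr rfl fun t _ => ?_) (sum_subset (s₁ := range s)
        (fun t ht => mem_range.2 (by have := mem_range.1 ht; omega)) fun t _ ht => ?_).symm
      · rw [show (k : ℕ) = a + 1 + s by omega, stepSum_shift,
          show gN (a + 1 + t) = resid h' T u (a + 1 + t - (a + 1)) from if_pos (by omega),
          Nat.add_sub_cancel_left]
      · rw [stepSum_eq_zero _ (by simpa using ht), zero_smul]
    rw [e1, sum_range_add, e2, zero_add, e3]
    simp only [z]
    rw [show (k : ℕ) - (a + 1) = s by omega, iter_eq_sub_sum h' T u s, sub_sub_cancel]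
  have hform := sum_inner_certMatrix H g
  have hsplit : ∑ k with a < ((k : Fin (a + b + 1 + 1)) : ℕ), inner ℝ
      (∑ l with a < ((l : Fin (a + b + 1 + 1)) : ℕ), certMatrix H k l • g l) (z k) =
      (((a + b + 1 : ℕ) : ℝ) + 1) * ‖g (Fin.last _)‖ ^ 2 := by
    rw [← hform, sum_filter]
    refine sum_congr rfl fun k _ => ?_
    split_ifs with hk
    · rw [hz k hk, sum_filter]
      congr 1
      refine sum_congr rfl fun l _ => ?_
      split_ifs with hl
      · rfl
      · rw [show g l = 0 from if_neg hl, smul_zero]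
    · rw [hz0 k hk, inner_zero_right]
  have hgr : ∀ k : Fin (a + b + 1 + 1), a < (k : ℕ) → g k = resid h' T u (k - (a + 1)) :=
    fun k hk => if_pos hk
  rw [sum_inner_eq_pairs_add_rowSum _ _ (certMatrix_symm H), sum_eq_zero, mul_zero, zero_add,
    sum_eq_single_of_mem (Fin.last _) (by simp), certMatrix_rowSum_right hrow hAB han,
    if_pos (by simp), if_pos rfl] at hsplit
  · have hlast : g (Fin.last (a + b + 1)) = resid h' T u b := by
      rw [hgr _ (by simp)]
      congr 1
      simp
    have hzlast : z (Fin.last (a + b + 1)) = (2 : ℝ) • (u - iter h' T u b) + resid h' T u b := by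
      simp only [z]
      rw [hlast]
      congr 4
      simp
    have h2 : inner ℝ (resid h' T u b) u = 2 := inner_resid_negShift h' le_rfl
    have h3 : 2 * inner ℝ (iter h' T u b) (resid h' T u b) = ‖resid h' T u b‖ ^ 2 :=
      inner_sub_negShift _
    have h4 : inner ℝ (g (Fin.last (a + b + 1))) (z (Fin.last (a + b + 1))) = 4 := by
      rw [hlast, hzlast, inner_add_right, real_inner_smul_right, inner_sub_right,
        real_inner_self_eq_norm_sq, h2, real_inner_comm]
      linarith
    have h5 := real_inner_mul_inner_self_le (resid h' T u b) u
    rw [real_inner_self_eq_norm_sq, real_inner_self_eq_norm_sq, norm_onesVec_sq, h2] at h5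
    rw [h4, hlast] at hsplit
    have e : ((a + b + 1 : ℕ) : ℝ) - a = (b : ℝ) + 1 := by push_cast; ring
    rw [e]
    have hb : (0 : ℝ) < (b : ℝ) + 1 := by positivity
    have hn : (0 : ℝ) ≤ ((a + b + 1 : ℕ) : ℝ) + 1 := by positivity
    nlinarith
  · intro k hk hkl
    have hk' : a < (k : ℕ) := by simpa using hk
    rw [certMatrix_rowSum_right hrow hAB han, if_pos hk', if_neg hkl, zero_mul]
  · intro k hk
    refine sum_eq_zero fun l hl => ?_
    have hk' : a < (k : ℕ) := by simpa using hk
    have hl' : a < (l : ℕ) := by simpa using hl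
    -- the negacyclic shift is an isometry, so all interpolation inequalities are tight
    have h1 := inner_sub_negShift (iter h' T u (k - (a + 1)) - iter h' T u (l - (a + 1)))
    have h2 : iter h' T u (k - (a + 1)) - iter h' T u (l - (a + 1)) -
        negShift b (iter h' T u (k - (a + 1)) - iter h' T u (l - (a + 1))) = g k - g l := by
      rw [← negShift_sub, sub_sub_sub_comm, hgr k hk', hgr l hl']; rfl
    rw [h2] at h1
    have h3 : z k - z l = (-2 : ℝ) • (iter h' T u (k - (a + 1)) - iter h' T u (l - (a + 1))) +
        (g k - g l) := by
      simp only [z]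
      module
    rw [h3, inner_add_right, real_inner_smul_right, real_inner_self_eq_norm_sq, real_inner_comm]
    linear_combination (-certMatrix H k l) * h1

/-- The initial block of a decomposable optimal method satisfies the certificate inequality. In the
Stein identity the residuals with index `> a` are replaced by the constant `c / (1 + c) • g_a`, for
which the rows of the certificate matrix with index `> a` vanish. -/
theorem certified_initial_block {X : Type*} [NormedAddCommGroup X] [InnerProductSpace ℝ X]
    (hrow : ∀ k, ∑ j, certMatrix H k j = if k = Fin.last n then 1 else 0)
    (hoff : ∀ k j, k ≠ j → certMatrix H k j ≤ 0)
    (hAB : ∀ k j : Fin (n + 1), a < k → j ≤ a →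
      certMatrix H k j = if k = Fin.last n ∧ (j : ℕ) = a then -c else 0) (han : a < n)
    (hc : 0 < c) : Certified X (ent H) a := by
  intro T hT y₀
  let κ := c / (1 + c)
  have hκ : 0 < κ := by positivity
  have hκc : (1 + c) * κ = c := by simp only [κ]; field_simp
  let r : ℕ → X := resid (ent H) T y₀
  let y : ℕ → X := iter (ent H) T y₀
  let w : X := κ • r a
  let g : Fin (n + 1) → X := fun k => if a < (k : ℕ) then w else r k
  let z : Fin (n + 1) → X := fun k => (2 : ℝ) • (y₀ - y k) + r k
  let aF : Fin (n + 1) := ⟨a, by omega⟩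
  have hright := certMatrix_rowSum_right hrow hAB han
  have hMg : ∀ k, ∑ l, certMatrix H k l • g l =
      ∑ l with ¬a < ((l : Fin (n + 1)) : ℕ), certMatrix H k l • g l +
        (∑ l with a < ((l : Fin (n + 1)) : ℕ), certMatrix H k l) • w := by
    intro k
    rw [← sum_filter_add_sum_filter_not univ (fun l : Fin (n + 1) => a < (l : ℕ)), add_comm,
      sum_smul]
    congr 1
    refine sum_congr rfl fun l hl => ?_
    rw [show g l = w from if_pos (by simpa using hl)]
  have hleft : ∀ k : Fin (n + 1), ¬a < (k : ℕ) →
      ∑ l with ¬a < ((l : Fin (n + 1)) : ℕ), certMatrix H k l = if (k : ℕ) = a then c else 0 := by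
    intro k hk
    have h1 := sum_filter_add_sum_filter_not univ (fun l : Fin (n + 1) => a < (l : ℕ))
      (certMatrix H k)
    rw [hright, if_neg hk, hrow,
      if_neg (show ¬k = Fin.last n by rintro rfl; exact hk (by simpa using han))] at h1
    split_ifs at h1 ⊢ <;> linarith
  have hB : ∀ k : Fin (n + 1), a < (k : ℕ) → ∑ l, certMatrix H k l • g l = 0 := by
    intro k hk
    rw [hMg, hright, if_pos hk]
    split_ifs with hkn
    · rw [sum_eq_single_of_mem aF (by simp [aF])]
      · rw [hAB _ _ hk le_rfl, if_pos ⟨hkn, rfl⟩,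
          show g aF = r a from if_neg (lt_irrefl a)]
        simp only [w]
        rw [smul_smul, hκc, neg_smul, neg_add_cancel]
      · intro l hl hla
        rw [hAB _ _ hk (by simpa using hl), if_neg, zero_smul]
        rintro ⟨-, h⟩
        exact hla (Fin.ext h)
    · rw [zero_smul, add_zero]
      refine sum_eq_zero fun l hl => ?_
      rw [hAB _ _ hk (by simpa using hl), if_neg fun h => hkn h.1, zero_smul]
  have hz : ∀ k : Fin (n + 1), ¬a < (k : ℕ) →
      (2 : ℝ) • ∑ j, stepMatrix H k j • g j + g k = z k := by
    intro k hk
    have e1 : ∑ j, stepMatrix H k j • g j = ∑ j : Fin (n + 1), stepMatrix H k j • r j := by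
      refine sum_congr rfl fun j _ => ?_
      rcases le_or_gt k j with hkj | hjk
      · rw [stepMatrix_eq_zero H hkj, zero_smul, zero_smul]
      · rw [show g j = r j from if_neg (by have : (j : ℕ) < k := hjk; omega)]
    have e2 : y k = y₀ - ∑ j : Fin (n + 1), stepMatrix H k j • r j :=
      iter_eq_sub_stepMatrix H T y₀ k
    rw [e1, show g k = r k from if_neg hk]
    simp only [z]
    rw [e2, sub_sub_cancel]
  have hform := sum_inner_certMatrix H g
  have hA : ∑ k with ¬a < ((k : Fin (n + 1)) : ℕ), inner ℝ
      (∑ l with ¬a < ((l : Fin (n + 1)) : ℕ), certMatrix H k l • g l) (z k) -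
        c * inner ℝ w (z aF) = ((n : ℝ) + 1) * ‖w‖ ^ 2 := by
    rw [show g (Fin.last n) = w from if_pos (by simpa using han),
      ← sum_filter_add_sum_filter_not univ (fun l : Fin (n + 1) => a < (l : ℕ)),
      sum_eq_zero (s := univ.filter fun l : Fin (n + 1) => a < (l : ℕ)), zero_add] at hform
    · rw [← hform]
      have e : ∀ k ∈ univ.filter (fun l : Fin (n + 1) => ¬a < (l : ℕ)),
          inner ℝ (∑ l, certMatrix H k l • g l) ((2 : ℝ) • ∑ j, stepMatrix H k j • g j + g k) =
          inner ℝ (∑ l with ¬a < ((l : Fin (n + 1)) : ℕ), certMatrix H k l • g l) (z k) +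
            (if k = aF then -(c * inner ℝ w (z aF)) else 0) := by
        intro k hk
        have hk' : ¬a < (k : ℕ) := by simpa using hk
        rw [hMg, hz k hk', hright, if_neg hk', inner_add_left, real_inner_smul_left]
        congr 1
        by_cases h : k = aF
        · rw [if_pos h, if_pos (by rw [h]), h]; ring
        · rw [if_neg h, if_neg fun h' => h (Fin.ext h'), zero_mul]
      rw [sum_congr rfl e, sum_add_distrib, sum_ite_eq' _ aF, if_pos (by simp [aF])]
      ring
    · intro k hk
      rw [hB k (by simpa using hk), inner_zero_left]
  rw [sum_inner_eq_pairs_add_rowSum _ _ (certMatrix_symm H), sum_eq_single_of_mem (s :=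
    univ.filter fun l : Fin (n + 1) => ¬a < (l : ℕ)) (f := fun k => (∑ l with
      ¬a < ((l : Fin (n + 1)) : ℕ), certMatrix H k l) * inner ℝ (g k) (z k)) aF (by simp [aF]),
    hleft aF (lt_irrefl a), if_pos rfl, show g aF = r a from if_neg (lt_irrefl a)] at hA
  · have hpairs : 0 ≤ ∑ k with ¬a < ((k : Fin (n + 1)) : ℕ),
        ∑ l with ¬a < ((l : Fin (n + 1)) : ℕ),
          certMatrix H k l * inner ℝ (g k - g l) (z k - z l) := by
      refine sum_nonneg fun k hk => sum_nonneg fun l hl => ?_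
      rcases eq_or_ne k l with rfl | hkl
      · simp
      refine mul_nonneg_of_nonpos_of_nonpos (hoff k l hkl) ?_
      have hk' : g k = r k := if_neg (by simpa using hk)
      have hl' : g l = r l := if_neg (by simpa using hl)
      have h1 : ‖r k - r l‖ ^ 2 ≤ 2 * inner ℝ (y k - y l) (r k - r l) :=
        norm_sq_sub_le_two_mul_inner hT (y k) (y l)
      have h3 : z k - z l = (-2 : ℝ) • (y k - y l) + (r k - r l) := by
        simp only [z]
        module
      rw [hk', hl', h3, inner_add_right, real_inner_smul_right, real_inner_self_eq_norm_sq,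
        real_inner_comm]
      linarith
    have hlow := coupling_lower_bound hrow hAB han
    have hκn : (a : ℝ) + 1 ≤ κ * ((n : ℝ) + 1) := by
      have : (1 + c) * ((a : ℝ) + 1) ≤ (1 + c) * (κ * ((n : ℝ) + 1)) := by
        rw [← mul_assoc, hκc]; linarith
      exact le_of_mul_le_mul_left this (by linarith)
    change ((a : ℝ) + 1) * ‖r a‖ ^ 2 ≤ inner ℝ (r a) (z aF)
    have hw : inner ℝ w (z aF) = κ * inner ℝ (r a) (z aF) := real_inner_smul_left _ _ _
    have hw2 : ‖w‖ ^ 2 = κ ^ 2 * ‖r a‖ ^ 2 := by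
      simp only [w]
      rw [norm_smul, mul_pow, Real.norm_eq_abs, sq_abs]
    rw [hw, hw2] at hA
    have h1 : κ * ((κ * ((n : ℝ) + 1)) * ‖r a‖ ^ 2) ≤ κ * inner ℝ (r a) (z aF) := by
      have : c - c * κ = κ := by linarith
      have h2 : c * inner ℝ (r a) (z aF) - c * (κ * inner ℝ (r a) (z aF)) =
        κ * inner ℝ (r a) (z aF) := by rw [← mul_assoc, ← sub_mul, this]
      linarith
    have h2 := le_of_mul_le_mul_left h1 hκ
    have h3 := mul_le_mul_of_nonneg_right hκn (sq_nonneg ‖r a‖)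
    linarith
  · intro k hk hka
    rw [hleft k (by simpa using hk), if_neg fun h => hka (Fin.ext h), zero_mul]

end Block

/-! ### The glued column -/

/-- A matrix is regular if its diagonal does not vanish and its method has, for the scalar
operators `T = 1 - z`, the residual `(1 - (1 - z)^N) / N` after `n = N - 1` steps. The second
condition is the generating function of the invariants `∑_j Q(m, j; H) = binom(N, m + 1) / N`. -/
structure Regular {n : ℕ} (H : Matrix (Fin n) (Fin n) ℝ) : Prop where
  diag : ∀ i, 1 ≤ i → i ≤ n → ent H i i ≠ 0
  scalar : ∀ z : ℝ, z ≠ 0 → resid (ent H) (fun x : ℝ => (1 - z) * x) 1 n =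
    (1 - (1 - z) ^ (n + 1)) / ((n : ℝ) + 1)

theorem coeff_eq_zero_of_forall_ne_zero (N : ℕ) (c : ℕ → ℝ)
    (h : ∀ x : ℝ, x ≠ 0 → ∑ m ∈ range N, c m * x ^ m = 0) : ∀ m < N, c m = 0 := by
  let p : Polynomial ℝ := ∑ m ∈ range N, Polynomial.C (c m) * Polynomial.X ^ m
  have hp : p = 0 := by
    refine Polynomial.eq_zero_of_infinite_isRoot p ((Set.Ioi_infinite (0 : ℝ)).mono fun x hx => ?_)
    have := h x (ne_of_gt hx)
    simpa [p, Polynomial.IsRoot, Polynomial.eval_finsetSum] using this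
  intro m hm
  have h1 : p.coeff m = c m := by
    simp only [p, Polynomial.finsetSum_coeff, Polynomial.coeff_C_mul_X_pow]
    rw [sum_ite_eq (range N) m c, if_pos (mem_range.2 hm)]
  rw [← h1, hp, Polynomial.coeff_zero]

/-- The residual polynomial of a method for the scalar operators `1 - z`. -/
theorem resid_scalar {n : ℕ} (H : Matrix (Fin n) (Fin n) ℝ) (z : ℝ) :
    resid (ent H) (fun x : ℝ => (1 - z) * x) 1 n =
      z * ∑ m ∈ range (n + 1), (-z) ^ m * ∑ j, (stepMatrix H ^ m) (Fin.last n) j := by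
  let y : Fin (n + 1) → ℝ := fun k =>
    ∑ m ∈ range (n + 1), (-z) ^ m * ∑ j, (stepMatrix H ^ m) k j
  have hy : ∀ k, 1 - ∑ j, stepMatrix H k j • (z * y j) = y k := by
    intro k
    have h1 : ∑ j, stepMatrix H k j • (z * y j) =
        -∑ m ∈ range (n + 1), (-z) ^ (m + 1) * ∑ j, (stepMatrix H ^ (m + 1)) k j := by
      simp only [y, smul_eq_mul, mul_sum]
      rw [sum_comm, ← sum_neg_distrib]
      refine sum_congr rfl fun m _ => ?_
      simp_rw [pow_succ' (stepMatrix H), Matrix.mul_apply]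
      simp_rw [mul_sum]
      rw [sum_comm (s := univ) (t := univ), ← sum_neg_distrib]
      refine sum_congr rfl fun j _ => ?_
      rw [← sum_neg_distrib]
      exact sum_congr rfl fun i _ => by ring
    have h2 := sum_range_succ' (fun m => (-z) ^ m * ∑ j, (stepMatrix H ^ m) k j) (n + 1)
    rw [sum_range_succ, stepMatrix_pow_card] at h2
    simp only [Matrix.zero_apply, sum_const_zero, mul_zero, add_zero, pow_zero, one_mul,
      Matrix.one_apply, sum_ite_eq, mem_univ, if_true] at h2
    rw [h1]
    simp only [y]
    linarith
  have := resid_eq_of_interpolation H (fun x : ℝ => (1 - z) * x) 1 (fun k => z * y k)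
    (fun k => by rw [hy]; ring) (Fin.last n)
  exact this

/-- The invariants of a regular matrix. -/
theorem Regular.sum_Q {n : ℕ} {H : Matrix (Fin n) (Fin n) ℝ} (hH : Regular H) (m : ℕ) (hm : m ≤ n) :
    ∑ j, (stepMatrix H ^ m) (Fin.last n) j = ((n + 1).choose (m + 1) : ℝ) / ((n : ℝ) + 1) := by
  have hN : ((n : ℝ) + 1) ≠ 0 := by positivity
  have key := coeff_eq_zero_of_forall_ne_zero (n + 1) (fun m =>
    ∑ j, (stepMatrix H ^ m) (Fin.last n) j - ((n + 1).choose (m + 1) : ℝ) / ((n : ℝ) + 1))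
    (fun x hx => by
      have h1 := hH.scalar (-x) (neg_ne_zero.2 hx)
      rw [resid_scalar, neg_neg] at h1
      have h2 : (1 - -x) ^ (n + 1) =
          1 + x * ∑ m ∈ range (n + 1), ((n + 1).choose (m + 1) : ℝ) * x ^ m := by
        rw [sub_neg_eq_add, add_comm, add_pow, sum_range_succ', mul_sum]
        simp only [one_pow, mul_one, pow_zero, Nat.choose_zero_right, Nat.cast_one]
        rw [add_comm]
        congr 1
        exact sum_congr rfl fun m _ => by ring
      rw [h2] at h1
      have h3 : x * ∑ m ∈ range (n + 1), (∑ j, (stepMatrix H ^ m) (Fin.last n) j -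
          ((n + 1).choose (m + 1) : ℝ) / ((n : ℝ) + 1)) * x ^ m = 0 := by
        have e : ∀ m, (∑ j, (stepMatrix H ^ m) (Fin.last n) j -
            ((n + 1).choose (m + 1) : ℝ) / ((n : ℝ) + 1)) * x ^ m =
            x ^ m * ∑ j, (stepMatrix H ^ m) (Fin.last n) j -
            (((n + 1).choose (m + 1) : ℝ) * x ^ m) / ((n : ℝ) + 1) := fun m => by ring
        simp_rw [e, sum_sub_distrib, ← sum_div]
        field_simp at h1 ⊢
        linarith
      exact (mul_eq_zero.1 h3).resolve_left hx) m (by omega)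
  exact sub_eq_zero.1 key

theorem Q_eq_zero_of_lt {n : ℕ} (H : Matrix (Fin n) (Fin n) ℝ) (m j : ℕ) (h : n ≤ m + j) :
    Q H (m + 1) (j + 1) = 0 := by
  rcases le_or_gt j n with hj | hj
  · have := stepMatrix_pow_last H m ⟨j, by omega⟩
    rw [strictLower_pow_eq_zero (fun _ _ h => stepMatrix_eq_zero H h) _ _ _
      (by simp only [Fin.val_last]; omega)] at this
    exact this.symm
  · exact Q_eq_zero H _ (by omega)

theorem Q_ne_zero {n : ℕ} {H : Matrix (Fin n) (Fin n) ℝ}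
    (hH : ∀ i, 1 ≤ i → i ≤ n → ent H i i ≠ 0) (m j : ℕ) (h : m + j + 1 = n) :
    Q H (m + 1) (j + 1) ≠ 0 := by
  induction m generalizing j with
  | zero =>
    obtain rfl : n = j + 1 := by omega
    rw [Q_one, stepSum, Icc_self, sum_singleton]
    exact hH _ (by omega) le_rfl
  | succ m ih =>
    rw [Q_succ_succ, sum_eq_single_of_mem (j + 1) (mem_range.2 (by omega))]
    · refine mul_ne_zero (ih (j + 1) (by omega)) ?_
      rw [stepSum, Icc_self, sum_singleton]
      exact hH _ (by omega) (by omega)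
    · intro l _ hl
      rcases lt_or_gt_of_ne hl with hl | hl
      · rw [stepSum_eq_zero _ (by omega), mul_zero]
      · rw [Q_eq_zero_of_lt H m l (by omega), zero_mul]

/-- The sum of the accumulated step sizes, `(S 1)_t`. -/
noncomputable def stepTotal (h : ℕ → ℕ → ℝ) (t : ℕ) : ℝ := ∑ j ∈ range t, stepSum h t j

theorem stepTotal_succ (h : ℕ → ℕ → ℝ) (t : ℕ) :
    stepTotal h (t + 1) = stepTotal h t + ∑ j ∈ Icc 1 (t + 1), h (t + 1) j := by
  have h1 : ∑ j ∈ Icc 1 (t + 1), h (t + 1) j = ∑ j ∈ range (t + 1), h (t + 1) (j + 1) := by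
    rw [range_eq_Ico, sum_Ico_add' (fun j => h (t + 1) j)]
    rfl
  have h2 : stepTotal h t = ∑ j ∈ range (t + 1), stepSum h t j := by
    rw [sum_range_succ, stepSum_eq_zero h le_rfl, add_zero, stepTotal]
  rw [h1, h2, stepTotal, ← sum_add_distrib]
  exact sum_congr rfl fun j hj => stepSum_succ h (by have := mem_range.1 hj; omega)

theorem glueQ_succ (a b k : ℕ) (hk : k ≤ b) :
    glueQ a b (k + 1) = ((a : ℝ) + 1) / ((a : ℝ) + b + 2) *
      (((b : ℝ) + 1) * (((b + 1).choose (k + 1) : ℝ) / ((b : ℝ) + 1)) -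
        ((b + 1).choose (k + 2) : ℝ) / ((b : ℝ) + 1)) := by
  have h1 : ((b : ℝ) + 1) * (b.choose k : ℝ) = ((b + 1).choose (k + 1) : ℝ) * ((k : ℝ) + 1) := by
    exact_mod_cast Nat.add_one_mul_choose_eq b k
  have h2 : ((b + 1).choose (k + 2) : ℝ) * ((k : ℝ) + 2) =
      ((b + 1).choose (k + 1) : ℝ) * ((b : ℝ) - k) := by
    have := Nat.choose_succ_right_eq (b + 1) (k + 1)
    rw [show b + 1 - (k + 1) = b - k by omega] at this
    rw [← Nat.cast_sub hk]
    exact_mod_cast this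
  have hb : (b : ℝ) + 1 ≠ 0 := by positivity
  have hk : (k : ℝ) + 2 ≠ 0 := by positivity
  have hab : (a : ℝ) + b + 2 ≠ 0 := by positivity
  have e1 : (b.choose k : ℝ) = ((b + 1).choose (k + 1) : ℝ) * ((k : ℝ) + 1) / ((b : ℝ) + 1) := by
    rw [← h1]; field_simp
  have e2 : ((b + 1).choose (k + 2) : ℝ) =
      ((b + 1).choose (k + 1) : ℝ) * ((b : ℝ) - k) / ((k : ℝ) + 2) := by
    rw [← h2]; field_simp
  rw [glueQ, Nat.add_sub_cancel, e1, e2]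
  push_cast
  rw [show (k : ℝ) + 1 + 1 = k + 2 by ring]
  field_simp
  ring

theorem glueCol_zero (a : ℕ) {b : ℕ} (H₂ : Matrix (Fin b) (Fin b) ℝ) :
    glueCol a H₂ 0 = ((a : ℝ) + 1) * ((b : ℝ) + 1) / ((a : ℝ) + b + 2) := by
  rw [glueCol]

/-- Solution of the linear system that defines the glued column, by its partial sums. -/
theorem sum_glueCol (a : ℕ) {b : ℕ} {H₂ : Matrix (Fin b) (Fin b) ℝ} (hH : Regular H₂) (t : ℕ)
    (ht : t ≤ b) : ∑ m ∈ range (t + 1), glueCol a H₂ m =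
      ((a : ℝ) + 1) / ((a : ℝ) + b + 2) * (((b : ℝ) + 1) - stepTotal (ent H₂) t) := by
  induction t using Nat.strong_induction_on with
  | _ t ih =>
    match t with
    | 0 =>
      rw [sum_range_one, glueCol_zero, stepTotal, sum_range_zero]
      ring
    | s + 1 =>
      rw [sum_range_succ, glueCol, ← sum_range (fun m => glueCol a H₂ m)]
      have hq : ∀ k, k + 1 ≤ b → ∑ j ∈ range (b + 1), Q H₂ (k + 1) (j + 1) =
          ((b + 1).choose (k + 2) : ℝ) / ((b : ℝ) + 1) := by
        intro k hk
        rw [← hH.sum_Q (k + 1) hk, sum_range]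
        exact sum_congr rfl fun j _ => (stepMatrix_pow_last H₂ k j).symm
      split_ifs with hsb
      · have h1 := hq 0 (by omega)
        have h2 : stepTotal (ent H₂) b = ∑ j ∈ range (b + 1), Q H₂ (0 + 1) (j + 1) := by
          rw [sum_range_succ, Q_eq_zero_of_lt H₂ 0 b (by omega), add_zero, stepTotal]
          exact sum_congr rfl fun j _ => (Q_one H₂ j).symm
        have h3 := glueQ_succ a b 0 (by omega)
        simp only [zero_add, Nat.choose_one_right, Nat.cast_add, Nat.cast_one] at h3
        rw [hsb, h2, h1, add_sub_cancel, h3]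
        have hb : (b : ℝ) + 1 ≠ 0 := by positivity
        field_simp
      · obtain ⟨k, hk⟩ : ∃ k, b - (s + 1) = k + 1 := ⟨b - (s + 1) - 1, by omega⟩
        rw [hk, add_sub_cancel]
        have hne : Q H₂ (k + 1) (s + 2) ≠ 0 := Q_ne_zero hH.diag k (s + 1) (by omega)
        rw [one_div, inv_mul_eq_iff_eq_mul₀ hne, sub_eq_iff_eq_add]
        have h1 : ∑ t : Fin (s + 1), (∑ m : Fin ((t : ℕ) + 1), glueCol a H₂ m) *
            Q H₂ (k + 1) (t + 1) = ∑ t ∈ range (s + 1), ((a : ℝ) + 1) / ((a : ℝ) + b + 2) *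
              (((b : ℝ) + 1) - stepTotal (ent H₂) t) * Q H₂ (k + 1) (t + 1) := by
          rw [sum_range]
          refine sum_congr rfl fun t _ => ?_
          rw [← ih t (by omega) (by omega), sum_range (fun m => glueCol a H₂ m)]
        have h2 : ∑ t ∈ range (b + 1), ((a : ℝ) + 1) / ((a : ℝ) + b + 2) *
            (((b : ℝ) + 1) - stepTotal (ent H₂) t) * Q H₂ (k + 1) (t + 1) =
            ∑ t ∈ range (s + 1 + 1), ((a : ℝ) + 1) / ((a : ℝ) + b + 2) *
              (((b : ℝ) + 1) - stepTotal (ent H₂) t) * Q H₂ (k + 1) (t + 1) := by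
          refine (sum_subset (fun t ht => mem_range.2 ?_) fun t _ ht => ?_).symm
          · have := mem_range.1 ht; omega
          · rw [Q_eq_zero_of_lt H₂ k t (by rw [mem_range] at ht; omega), mul_zero]
        have h3 : ∑ t ∈ range (b + 1), stepTotal (ent H₂) t * Q H₂ (k + 1) (t + 1) =
            ∑ j ∈ range (b + 1), Q H₂ (k + 1 + 1) (j + 1) := by
          have e : ∀ t ∈ range (b + 1), stepTotal (ent H₂) t * Q H₂ (k + 1) (t + 1) =
              ∑ j ∈ range (b + 1), Q H₂ (k + 1) (t + 1) * stepSum (ent H₂) t j := by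
            intro t ht
            have := mem_range.1 ht
            rw [← mul_sum, mul_comm, stepTotal]
            congr 1
            refine sum_subset (fun j hj => mem_range.2 ?_) fun j _ hj => ?_
            · have := mem_range.1 hj; omega
            · exact stepSum_eq_zero _ (by simpa using hj)
          rw [sum_congr rfl e, sum_comm]
          exact sum_congr rfl fun j _ => (Q_succ_succ H₂ k j).symm
        have h4 : ∑ t ∈ range (b + 1), ((a : ℝ) + 1) / ((a : ℝ) + b + 2) *
            (((b : ℝ) + 1) - stepTotal (ent H₂) t) * Q H₂ (k + 1) (t + 1) =
            ((a : ℝ) + 1) / ((a : ℝ) + b + 2) *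
              (((b : ℝ) + 1) * ∑ j ∈ range (b + 1), Q H₂ (k + 1) (j + 1) -
                ∑ j ∈ range (b + 1), Q H₂ (k + 1 + 1) (j + 1)) := by
          rw [← h3, mul_sum, ← sum_sub_distrib, mul_sum]
          exact sum_congr rfl fun t _ => by ring
        rw [hq k (by omega), hq (k + 1) (by omega), ← glueQ_succ a b (k + 1) (by omega), h2,
          sum_range_succ] at h4
        rw [h1, ← h4]
        ring

theorem glueCol_succ (a : ℕ) {b : ℕ} {H₂ : Matrix (Fin b) (Fin b) ℝ} (hH : Regular H₂) (s : ℕ)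
    (hs : s + 1 ≤ b) : glueCol a H₂ (s + 1) =
      -(((a : ℝ) + 1) / ((a : ℝ) + b + 2)) * ∑ j ∈ Icc 1 (s + 1), ent H₂ (s + 1) j := by
  have h1 := sum_glueCol a hH (s + 1) hs
  rw [sum_range_succ, sum_glueCol a hH s (by omega), stepTotal_succ] at h1
  linear_combination h1

/-! ### Gluing -/

section Glue

variable {a b : ℕ} (H₁ : Matrix (Fin a) (Fin a) ℝ) (H₂ : Matrix (Fin b) (Fin b) ℝ)

theorem ent_glue_row {j : ℕ} (hj : 1 ≤ j) (hja : j ≤ a) : ent (glue H₁ H₂) (a + 1) j =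
    -(((b : ℝ) + 1) / ((a : ℝ) + b + 2)) * ∑ k ∈ Icc j a, ent H₁ k j := by
  rw [glue, ent_ofEnt _ ⟨by omega, by omega⟩ ⟨hj, by omega⟩, if_neg (by omega),
    if_pos ⟨rfl, hja⟩]

theorem ent_glue_eq_zero {s j : ℕ} (hj : j ≤ a) : ent (glue H₁ H₂) (a + 1 + (s + 1)) j = 0 := by
  by_cases h : (1 ≤ a + 1 + (s + 1) ∧ a + 1 + (s + 1) ≤ a + b + 1) ∧ (1 ≤ j ∧ j ≤ a + b + 1)
  · rw [glue, ent_ofEnt _ h.1 h.2, if_neg (by omega), if_neg (by omega), if_pos hj]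
  · exact ent_eq_zero _ h

theorem ent_glue_col {s : ℕ} (hs : s ≤ b) :
    ent (glue H₁ H₂) (a + 1 + s) (a + 1) = glueCol a H₂ s := by
  rw [glue, ent_ofEnt _ ⟨by omega, by omega⟩ ⟨by omega, by omega⟩, if_neg (by omega),
    if_neg (by omega), if_neg (by omega), if_pos rfl, Nat.add_sub_cancel_left]

theorem ent_glue_block {s t : ℕ} (ht : 1 ≤ t) :
    ent (glue H₁ H₂) (a + 1 + s) (a + 1 + t) = ent H₂ s t := by
  by_cases h : s ≤ b ∧ t ≤ b
  · rw [glue, ent_ofEnt _ ⟨by omega, by omega⟩ ⟨by omega, by omega⟩, if_neg (by omega),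
      if_neg (by omega), if_neg (by omega), if_neg (by omega), Nat.add_sub_cancel_left,
      Nat.add_sub_cancel_left]
  · rw [ent_eq_zero _ (by omega), ent_eq_zero _ (by omega)]

theorem stepSum_glue_left {t j : ℕ} (hj : j < a) :
    stepSum (ent (glue H₁ H₂)) (a + 1 + t) j =
      ((a : ℝ) + 1) / ((a : ℝ) + b + 2) * stepSum (ent H₁) a j := by
  have hab : (a : ℝ) + b + 2 ≠ 0 := by positivity
  induction t with
  | zero =>
    rw [add_zero, stepSum_succ _ hj.le, ent_glue_row _ _ (by omega) (by omega)]
    have : stepSum (ent (glue H₁ H₂)) a j = stepSum (ent H₁) a j :=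
      sum_congr rfl fun i hi => ent_glue _ _ (mem_Icc.1 hi).2
    rw [this, ← stepSum]
    field_simp
    ring
  | succ t ih =>
    rw [← add_assoc, stepSum_succ _ (by omega), ih, add_assoc (a + 1) t 1,
      ent_glue_eq_zero _ _ (by omega), add_zero]

theorem stepSum_glue_col {t : ℕ} (ht : t ≤ b) :
    stepSum (ent (glue H₁ H₂)) (a + 1 + t) a = ∑ m ∈ range (t + 1), glueCol a H₂ m := by
  induction t with
  | zero =>
    rw [stepSum_succ _ le_rfl, stepSum_eq_zero _ le_rfl, zero_add, sum_range_one]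
    exact ent_glue_col H₁ H₂ (Nat.zero_le b)
  | succ t ih =>
    rw [← add_assoc, stepSum_succ _ (by omega), ih (by omega), add_assoc (a + 1) t 1,
      ent_glue_col _ _ ht, sum_range_succ _ (t + 1)]

theorem stepSum_glue_block (s t : ℕ) :
    stepSum (ent (glue H₁ H₂)) (a + 1 + s) (a + 1 + t) = stepSum (ent H₂) s t := by
  rw [stepSum_shift]
  exact sum_congr rfl fun i _ => ent_glue_block _ _ (by omega)

section GlueIter

variable {H₂} {X : Type*} [AddCommGroup X] [Module ℝ X]

/-- The second block of a glued method runs the method of `H₂` on the operator `T + α g`, whose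
residuals are shifted by a multiple of the residual `g` at the end of the first block, from a
modified starting point; here `α = N' / N`. -/
theorem iter_glue_right (hH : Regular H₂) (T : X → X) (y₀ : X) (t : ℕ) (ht : t ≤ b) :
    iter (ent (glue H₁ H₂)) T y₀ (a + 1 + t) =
      iter (ent H₂)
        (fun x => T x + (((a : ℝ) + 1) / ((a : ℝ) + b + 2)) • resid (ent H₁) T y₀ a)
        (y₀ - (((a : ℝ) + 1) / ((a : ℝ) + b + 2)) • (y₀ - iter (ent H₁) T y₀ a) -
          (((a : ℝ) + 1) / ((a : ℝ) + b + 2) * ((b : ℝ) + 1)) • resid (ent H₁) T y₀ a) t := by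
  set α : ℝ := ((a : ℝ) + 1) / ((a : ℝ) + b + 2) with hα
  set g := resid (ent H₁) T y₀ a with hg
  set T' : X → X := fun x => T x + α • g with hT'
  set v : X := y₀ - α • (y₀ - iter (ent H₁) T y₀ a) - (α * ((b : ℝ) + 1)) • g with hv
  induction t using Nat.strong_induction_on with
  | _ t ih =>
    have hres : ∀ j ≤ a, resid (ent (glue H₁ H₂)) T y₀ j = resid (ent H₁) T y₀ j := by
      intro j hj
      rw [resid, iter_congr (h' := ent H₁) T y₀ j fun _ _ _ _ hi => ent_glue _ _ (hi.trans hj)]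
      rfl
    have hres' : ∀ s < t, resid (ent (glue H₁ H₂)) T y₀ (a + 1 + s) = resid (ent H₂) T' v s + α • g :=
      fun s hs => by
        rw [resid, ih s hs (by omega)]
        rw [resid]
        simp only [hT']
        abel
    have e1 : ∑ j ∈ range a, stepSum (ent (glue H₁ H₂)) (a + 1 + t) j •
        resid (ent (glue H₁ H₂)) T y₀ j = α • (y₀ - iter (ent H₁) T y₀ a) := by
      rw [iter_eq_sub_sum, sub_sub_cancel, smul_sum]
      refine sum_congr rfl fun j hj => ?_
      have := mem_range.1 hj
      rw [stepSum_glue_left _ _ this, hres j this.le, mul_smul]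
    have e2 : ∑ s ∈ range t, stepSum (ent (glue H₁ H₂)) (a + 1 + t) (a + 1 + s) •
        resid (ent (glue H₁ H₂)) T y₀ (a + 1 + s) =
        ∑ s ∈ range t, stepSum (ent H₂) t s • resid (ent H₂) T' v s +
          (α * stepTotal (ent H₂) t) • g := by
      rw [stepTotal, mul_sum, sum_smul, ← sum_add_distrib]
      refine sum_congr rfl fun s hs => ?_
      rw [stepSum_glue_block, hres' s (mem_range.1 hs), smul_add, smul_smul, mul_comm α]
    rw [iter_eq_sub_sum, sum_range_add, sum_range_succ, e1, e2, stepSum_glue_col _ _ ht,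
      sum_glueCol a hH t ht, hres a le_rfl, ← hg, ← hα, iter_eq_sub_sum (ent H₂), hv]
    module

end GlueIter

variable {H₁ H₂}

/-- Gluing preserves the certificate inequality: it is a positive combination of the certificate
inequalities of the two blocks and of nonexpansiveness between the indices `N` and `N'`. -/
theorem certified_glue {X : Type*} [NormedAddCommGroup X] [InnerProductSpace ℝ X]
    (hH : Regular H₂) (h₁ : Certified X (ent H₁) a) (h₂ : Certified X (ent H₂) b) :
    Certified X (ent (glue H₁ H₂)) (a + b + 1) := by
  intro T hT y₀
  obtain ⟨α, hα⟩ : ∃ α : ℝ, α = ((a : ℝ) + 1) / ((a : ℝ) + b + 2) := ⟨_, rfl⟩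
  have hN : (0 : ℝ) < (a : ℝ) + b + 2 := by positivity
  have hα0 : 0 < α := by rw [hα]; positivity
  have hα1 : α < 1 := by rw [hα, div_lt_one hN]; linarith [(b.cast_nonneg : (0 : ℝ) ≤ b)]
  have hap : (a : ℝ) + 1 = α * ((a : ℝ) + b + 2) := by rw [hα]; field_simp
  have hbp : (b : ℝ) + 1 = (1 - α) * ((a : ℝ) + b + 2) := by linarith
  have i1 := h₁ T hT y₀
  have hT' : LipschitzWith 1 (fun x => T x + α • resid (ent H₁) T y₀ a) :=
    LipschitzWith.of_dist_le_mul fun x y => by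
      rw [dist_add_right]; exact hT.dist_le_mul x y
  have hit := iter_glue_right H₁ hH T y₀ b le_rfl
  rw [← hα, show a + 1 + b = a + b + 1 by omega] at hit
  have i2 := h₂ _ hT' (y₀ - α • (y₀ - iter (ent H₁) T y₀ a) -
    (α * ((b : ℝ) + 1)) • resid (ent H₁) T y₀ a)
  have i3 := norm_sq_sub_le_two_mul_inner hT (iter (ent (glue H₁ H₂)) T y₀ (a + b + 1))
    (iter (ent H₁) T y₀ a)
  have hr2 : resid (ent H₂) (fun x => T x + α • resid (ent H₁) T y₀ a)
      (y₀ - α • (y₀ - iter (ent H₁) T y₀ a) - (α * ((b : ℝ) + 1)) • resid (ent H₁) T y₀ a) b =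
      resid (ent (glue H₁ H₂)) T y₀ (a + b + 1) - α • resid (ent H₁) T y₀ a := by
    rw [resid, ← hit, show resid (ent (glue H₁ H₂)) T y₀ (a + b + 1) =
      iter (ent (glue H₁ H₂)) T y₀ (a + b + 1) - T (iter (ent (glue H₁ H₂)) T y₀ (a + b + 1))
      from rfl]
    abel
  rw [hr2, ← hit] at i2
  change ‖resid (ent (glue H₁ H₂)) T y₀ (a + b + 1) - resid (ent H₁) T y₀ a‖ ^ 2 ≤
    2 * inner ℝ _ (resid (ent (glue H₁ H₂)) T y₀ (a + b + 1) - resid (ent H₁) T y₀ a) at i3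
  set g := resid (ent (glue H₁ H₂)) T y₀ (a + b + 1)
  set p := resid (ent H₁) T y₀ a
  set y := iter (ent (glue H₁ H₂)) T y₀ (a + b + 1)
  set x := iter (ent H₁) T y₀ a
  obtain ⟨d, hd⟩ : ∃ d, d = y₀ - x := ⟨_, rfl⟩
  obtain ⟨e, he⟩ : ∃ e, e = y₀ - y := ⟨_, rfl⟩
  rw [show y - x = d - e by rw [hd, he]; abel] at i3
  rw [← hd, show y₀ - α • d - (α * ((b : ℝ) + 1)) • p - y = e - α • d - (α * ((b : ℝ) + 1)) • p by
    rw [he]; abel] at i2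
  rw [← hd] at i1
  rw [← he]
  simp only [← real_inner_self_eq_norm_sq, inner_add_right, inner_sub_left, inner_sub_right,
    real_inner_smul_left, real_inner_smul_right] at i1 i2 i3 ⊢
  rw [real_inner_comm p g, real_inner_comm p d, real_inner_comm p e, real_inner_comm g d,
    real_inner_comm g e] at *
  have hcast : ((a + b + 1 : ℕ) : ℝ) + 1 = (a : ℝ) + b + 2 := by push_cast; ring
  rw [hcast]
  rw [hap] at i1
  rw [hbp] at i2
  generalize (a : ℝ) + b + 2 = N at *
  refine le_of_mul_le_mul_left ?_ (show 0 < 1 - α by linarith)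
  have j1 := mul_le_mul_of_nonneg_left i1 (mul_nonneg hα0.le (show 0 ≤ 1 - α by linarith))
  have j3 := mul_le_mul_of_nonneg_left i3 hα0.le
  linear_combination j1 + i2 + j3

theorem iter_affine {h : ℕ → ℕ → ℝ} {T T' : ℝ → ℝ} {c s : ℝ}
    (hT : ∀ x, T' (c + s * x) = c + s * T x) (u : ℝ) (n : ℕ) :
    iter h T' (c + s * u) n = c + s * iter h T u n := by
  have key := iter_eq_of_recursion h T' (fun k => c + s * iter h T u k) n (fun k _ => ?_) n le_rfl
  · rwa [iter_zero] at key
  · rw [iter_succ, mul_sub, mul_sum, ← add_sub_assoc]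
    congr 1
    refine sum_congr rfl fun j _ => ?_
    rw [hT, resid, smul_eq_mul, smul_eq_mul]
    ring

theorem regular_glue (h₁ : Regular H₁) (h₂ : Regular H₂) : Regular (glue H₁ H₂) := by
  refine ⟨fun i hi hin => ?_, fun z hz => ?_⟩
  · rcases lt_trichotomy i (a + 1) with h | rfl | h
    · rw [ent_glue _ _ (by omega)]
      exact h₁.diag i hi (by omega)
    · have h := ent_glue_col H₁ H₂ (Nat.zero_le b)
      rw [add_zero] at h
      rw [h, glueCol_zero]
      positivity
    · obtain ⟨s, rfl⟩ : ∃ s, i = a + 1 + (s + 1) := ⟨i - (a + 2), by omega⟩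
      rw [ent_glue_block _ _ (by omega)]
      exact h₂.diag _ (by omega) (by omega)
  · obtain ⟨α, hα⟩ : ∃ α : ℝ, α = ((a : ℝ) + 1) / ((a : ℝ) + b + 2) := ⟨_, rfl⟩
    have hN : (a : ℝ) + b + 2 ≠ 0 := by positivity
    have hb : (b : ℝ) + 1 ≠ 0 := by positivity
    have ha : (a : ℝ) + 1 ≠ 0 := by positivity
    have hit := iter_glue_right H₁ h₂ (fun x : ℝ => (1 - z) * x) 1 b le_rfl
    have r1 := h₁.scalar z hz
    have r2 := h₂.scalar z hz
    set p := resid (ent H₁) (fun x : ℝ => (1 - z) * x) 1 a with hp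
    have hx : iter (ent H₁) (fun x : ℝ => (1 - z) * x) 1 a = p / z := by
      rw [hp, resid]; field_simp; ring
    -- the fixed point `c` of the shifted operator, and the scale `s` of the second block
    set c : ℝ := α * p / z with hc
    set s : ℝ := 1 - α - α * ((b : ℝ) + 1) * p with hs
    have hst : 1 - α • (1 - p / z) - (α * ((b : ℝ) + 1)) • p = c + s * 1 := by
      rw [hc, hs, smul_eq_mul, smul_eq_mul]; ring
    rw [← hα, hx, hst, iter_affine (T := fun x : ℝ => (1 - z) * x) (c := c) (s := s) (fun x => by
      simp only [smul_eq_mul, hc]; field_simp; ring), show a + 1 + b = a + b + 1 by omega] at hit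
    have hy : iter (ent H₂) (fun x : ℝ => (1 - z) * x) 1 b =
        (1 - (1 - z) ^ (b + 1)) / ((b : ℝ) + 1) / z := by
      rw [← r2, resid]; field_simp; ring
    rw [resid, hit, hy, hc, hs, r1, hα]
    have e : (1 - z) ^ (a + b + 1 + 1) = (1 - z) ^ (a + 1) * (1 - z) ^ (b + 1) := by
      rw [← pow_add]; congr 1; omega
    rw [e]
    generalize (1 - z) ^ (a + 1) = A
    generalize (1 - z) ^ (b + 1) = B
    have hcast : ((a + b + 1 : ℕ) : ℝ) + 1 = (a : ℝ) + b + 2 := by push_cast; ring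
    rw [hcast]
    field_simp
    ring

end Glue

/-! ### Dual-OHM and self-dual matrices -/

theorem Regular.recast {m n : ℕ} (h : n = m) {H : Matrix (Fin m) (Fin m) ℝ} (hH : Regular H) :
    Regular (recast h H) := by
  subst h; exact hH

theorem Certified.recast {X : Type*} [NormedAddCommGroup X] [InnerProductSpace ℝ X] {m n : ℕ}
    (h : n = m) {H : Matrix (Fin m) (Fin m) ℝ} (hH : Certified X (ent H) m) :
    Certified X (ent (recast h H)) n := by
  subst h; exact hH

theorem certified_zero (X : Type*) [NormedAddCommGroup X] [InnerProductSpace ℝ X] (h : ℕ → ℕ → ℝ) :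
    Certified X h 0 := by
  intro T _ y₀
  rw [iter_zero, sub_self, smul_zero, zero_add, real_inner_self_eq_norm_sq]
  simp

theorem certified_of_eq_zero (X : Type*) [NormedAddCommGroup X] [InnerProductSpace ℝ X]
    (h : ℕ → ℕ → ℝ) {n : ℕ} (hn : n = 0) : Certified X h n := by
  subst hn; exact certified_zero X h

theorem regular_zero (H : Matrix (Fin 0) (Fin 0) ℝ) : Regular H :=
  ⟨fun i h1 h2 => by omega, fun z _ => by rw [resid, iter_zero]; simp⟩

theorem ext_ent {n : ℕ} {H H' : Matrix (Fin n) (Fin n) ℝ}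
    (h : ∀ i j, 1 ≤ i → i ≤ n → 1 ≤ j → j ≤ n → ent H i j = ent H' i j) : H = H' := by
  ext i j
  have := h (i + 1) (j + 1) (by omega) (by omega) (by omega) (by omega)
  unfold ent at this
  rwa [dif_pos (by omega), dif_pos (by omega)] at this

theorem sum_Icc_dualOHM_row (b s : ℕ) (hs : 1 ≤ s) (hsb : s ≤ b) :
    ∑ l ∈ Icc 1 s, ent (dualOHM b) s l = ((b : ℝ) + 1 - s) / ((b : ℝ) + 1) := by
  obtain ⟨r, rfl⟩ := Nat.exists_eq_succ_of_ne_zero (show s ≠ 0 by omega)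
  have h1 : ∀ k ≤ r, ∑ l ∈ Icc 1 k, ent (dualOHM b) (r + 1) l =
      -((b : ℝ) + 1 - (r + 1)) * (1 / ((b : ℝ) + 1 - k) - 1 / ((b : ℝ) + 1)) := by
    intro k hk
    induction k with
    | zero => simp
    | succ k ih =>
      have hkb : (k : ℝ) + 1 ≤ b := by exact_mod_cast (by omega : k + 1 ≤ b)
      have e1 : (b : ℝ) + 1 - (k + 1) ≠ 0 := by linarith
      have e2 : (b : ℝ) + 1 - k ≠ 0 := by linarith
      rw [sum_Icc_succ_top (by omega), ih (by omega), dualOHM,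
        ent_ofEnt _ ⟨by omega, hsb⟩ ⟨by omega, by omega⟩, if_pos (by omega)]
      push_cast
      rw [show (b : ℝ) + 1 - (k + 1) + 1 = b + 1 - k by ring]
      have e3 : (b : ℝ) + 1 ≠ 0 := by positivity
      field_simp
      ring
  have hrb : (r : ℝ) + 1 ≤ b := by exact_mod_cast hsb
  have e1 : (b : ℝ) + 1 - r ≠ 0 := by linarith
  have e3 : (b : ℝ) + 1 ≠ 0 := by positivity
  rw [Nat.succ_eq_add_one, sum_Icc_succ_top (by omega), h1 r le_rfl, dualOHM,
    ent_ofEnt _ ⟨by omega, hsb⟩ ⟨by omega, hsb⟩, if_neg (lt_irrefl _), if_pos rfl]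
  push_cast
  rw [show (b : ℝ) + 1 - (r + 1) + 1 = b + 1 - r by ring]
  field_simp
  ring

/-- Dual-OHM arises by repeatedly gluing the empty matrix on the left. -/
theorem dualOHM_succ {b : ℕ} (hb : Regular (dualOHM b)) :
    dualOHM (b + 1) = recast (by omega) (glue (0 : Matrix (Fin 0) (Fin 0) ℝ) (dualOHM b)) := by
  refine ext_ent fun i j hi hib hj hjb => ?_
  obtain ⟨s, rfl⟩ : ∃ s, i = 0 + 1 + s := ⟨i - 1, by omega⟩
  have hsb : s ≤ b := by omega
  rw [ent_recast, dualOHM, ent_ofEnt _ ⟨hi, hib⟩ ⟨hj, hjb⟩]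
  have hb2 : (b : ℝ) + 2 ≠ 0 := by positivity
  have hb1 : (b : ℝ) + 1 ≠ 0 := by positivity
  rcases Nat.eq_or_lt_of_le hj with rfl | hj1
  · have h : ent (glue (0 : Matrix (Fin 0) (Fin 0) ℝ) (dualOHM b)) (0 + 1 + s) 1 =
        glueCol 0 (dualOHM b) s := ent_glue_col (0 : Matrix (Fin 0) (Fin 0) ℝ) (dualOHM b) hsb
    rw [h]
    cases s with
    | zero =>
      rw [if_neg (by omega), if_pos rfl, glueCol_zero]
      push_cast
      rw [show (b : ℝ) + 1 + 1 - 1 = b + 1 by ring]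
      field_simp
      ring
    | succ s =>
      rw [if_pos (by omega), glueCol_succ 0 hb s hsb, sum_Icc_dualOHM_row b _ (by omega) hsb]
      push_cast
      rw [show (b : ℝ) + 1 + 1 - 1 = b + 1 by ring]
      field_simp
      ring
  · obtain ⟨t, rfl⟩ : ∃ t, j = 0 + 1 + (t + 1) := ⟨j - 2, by omega⟩
    rw [ent_glue_block _ _ (by omega)]
    rcases Nat.eq_zero_or_pos s with rfl | hs
    · rw [if_neg (by omega), if_neg (by omega), ent_eq_zero _ (by omega)]
    · rw [dualOHM, ent_ofEnt _ ⟨by omega, hsb⟩ ⟨by omega, by omega⟩]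
      simp only [add_lt_add_iff_left, add_right_inj]
      push_cast
      rw [show (b : ℝ) + 1 + 1 - (1 + s) = b + 1 - s by ring,
        show (b : ℝ) + 1 + 1 - (1 + (t + 1)) = b + 1 - (t + 1) by ring]

theorem regular_dualOHM (b : ℕ) : Regular (dualOHM b) := by
  induction b with
  | zero => exact regular_zero _
  | succ b ih =>
    rw [dualOHM_succ ih]
    exact (regular_glue (regular_zero _) ih).recast _

theorem certified_dualOHM (X : Type*) [NormedAddCommGroup X] [InnerProductSpace ℝ X] (b : ℕ) :
    Certified X (ent (dualOHM b)) b := by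
  induction b with
  | zero => exact certified_zero X _
  | succ b ih =>
    rw [dualOHM_succ (regular_dualOHM b)]
    exact (certified_glue (regular_dualOHM b) (certified_zero X _) ih).recast _

theorem certified_rdoMatrix (X : Type*) [NormedAddCommGroup X] [InnerProductSpace ℝ X] (p : ℕ)
    (hp : 1 ≤ p) (n : ℕ) : Certified X (ent (rdoMatrix p hp n)) (n * p) := by
  induction n with
  | zero => exact certified_of_eq_zero X _ (zero_mul p)
  | succ n ih =>
    rw [rdoMatrix]
    exact (certified_glue (regular_dualOHM (p - 1)) ih (certified_dualOHM X (p - 1))).recast _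

/-- Self-duality: invariance under reflection along the anti-diagonal. -/
def SelfDual {n : ℕ} (H : Matrix (Fin n) (Fin n) ℝ) : Prop :=
  ∀ i j, 1 ≤ i → i ≤ n → 1 ≤ j → j ≤ n → ent H i j = ent H (n + 1 - j) (n + 1 - i)

theorem SelfDual.dual_eq {n : ℕ} {H : Matrix (Fin n) (Fin n) ℝ} (hH : SelfDual H) :
    dual H = H := by
  ext i j
  have h := hH (i + 1) (j + 1) (by omega) (by omega) (by omega) (by omega)
  unfold ent at h
  rw [dif_pos (by omega), dif_pos (by omega)] at h
  rw [dual, Matrix.of_apply]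
  refine Eq.trans ?_ h.symm
  congr 1 <;> ext <;> simp [Fin.val_rev] <;> omega

theorem SelfDual.recast {m n : ℕ} (h : n = m) {H : Matrix (Fin m) (Fin m) ℝ} (hH : SelfDual H) :
    SelfDual (recast h H) := by
  subst h; exact hH

/-- The row `N'` of `H ⋈ H` mirrors its column `N'` for self-dual `H`. -/
theorem ent_glue_self_row {m : ℕ} {H : Matrix (Fin m) (Fin m) ℝ} (hR : Regular H)
    (hS : SelfDual H) {j : ℕ} (hj : 1 ≤ j) (hjm : j ≤ m) :
    ent (glue H H) (m + 1) j = ent (glue H H) (m + m + 1 + 1 - j) (m + 1) := by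
  obtain ⟨s, rfl⟩ : ∃ s, m = j + s := ⟨m - j, by omega⟩
  rw [show j + s + (j + s) + 1 + 1 - j = j + s + 1 + (s + 1) by omega,
    ent_glue_col _ _ (by omega), ent_glue_row _ _ hj hjm, glueCol_succ _ hR s (by omega)]
  refine congrArg _ (sum_bij' (fun k _ => j + s + 1 - k) (fun l _ => j + s + 1 - l)
    ?_ ?_ ?_ ?_ ?_)
  · intro k hk; rw [mem_Icc] at hk ⊢; omega
  · intro l hl; rw [mem_Icc] at hl ⊢; omega
  · intro k hk; rw [mem_Icc] at hk; omega
  · intro l hl; rw [mem_Icc] at hl; omega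
  · intro k hk
    rw [mem_Icc] at hk
    rw [hS k j (by omega) (by omega) hj hjm]
    congr 1; omega

theorem selfDual_glue {m : ℕ} {H : Matrix (Fin m) (Fin m) ℝ} (hR : Regular H) (hS : SelfDual H) :
    SelfDual (glue H H) := by
  intro i j hi him hj hjm
  rcases lt_trichotomy i (m + 1) with h | rfl | h
  · rw [ent_glue _ _ (by omega)]
    rcases le_or_gt j m with hjm' | hjm'
    · rw [show m + m + 1 + 1 - j = m + 1 + (m + 1 - j) by omega,
        show m + m + 1 + 1 - i = m + 1 + (m + 1 - i) by omega, ent_glue_block _ _ (by omega)]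
      exact hS i j hi (by omega) hj hjm'
    · rw [ent_eq_zero _ (by omega), show m + m + 1 + 1 - i = m + 1 + (m + 1 - i) by omega]
      rcases Nat.eq_or_lt_of_le hjm' with hj' | hj'
      · rw [show m + m + 1 + 1 - j = m + 1 + 0 by omega, ent_glue_block _ _ (by omega),
          ent_eq_zero _ (by omega)]
      · rw [ent_glue _ _ (by omega), ent_eq_zero _ (by omega)]
  · rw [show m + m + 1 + 1 - (m + 1) = m + 1 by omega]
    rcases lt_trichotomy j (m + 1) with hj' | rfl | hj'
    · exact ent_glue_self_row hR hS hj (by omega)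
    · rw [show m + m + 1 + 1 - (m + 1) = m + 1 by omega]
    · obtain ⟨t, rfl⟩ : ∃ t, j = m + 1 + (t + 1) := ⟨j - (m + 2), by omega⟩
      have h0 := ent_glue_block H H (s := 0) (t := t + 1) (by omega)
      rw [add_zero] at h0
      rw [h0, ent_eq_zero _ (by omega), ent_glue _ _ (by omega), ent_eq_zero _ (by omega)]
  · obtain ⟨s, rfl⟩ : ∃ s, i = m + 1 + (s + 1) := ⟨i - (m + 2), by omega⟩
    rcases lt_trichotomy j (m + 1) with hj' | rfl | hj'
    · rw [ent_glue_eq_zero _ _ (by omega)]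
      obtain ⟨t, ht⟩ : ∃ t, m + m + 1 + 1 - j = m + 1 + (t + 1) := ⟨m - j, by omega⟩
      rw [ht, ent_glue_eq_zero _ _ (by omega)]
    · rw [show m + m + 1 + 1 - (m + 1) = m + 1 by omega, ent_glue_self_row hR hS (by omega)
        (by omega),
        show m + m + 1 + 1 - (m + m + 1 + 1 - (m + 1 + (s + 1))) = m + 1 + (s + 1) by omega]
    · obtain ⟨t, rfl⟩ : ∃ t, j = m + 1 + (t + 1) := ⟨j - (m + 2), by omega⟩
      rw [ent_glue_block _ _ (by omega), ent_glue _ _ (by omega),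
        hS _ _ (by omega) (by omega) (by omega) (by omega)]
      congr 1 <;> omega

/-- Self-duality of the factor turns the recursion of FSDM into `H ↦ H ⋈ H`, which preserves all
three properties. -/
theorem fsdmMatrix_spec (X : Type*) [NormedAddCommGroup X] [InnerProductSpace ℝ X] (n : ℕ) :
    Regular (fsdmMatrix n) ∧ SelfDual (fsdmMatrix n) ∧
      Certified X (ent (fsdmMatrix n)) (2 ^ n - 1) := by
  induction n with
  | zero =>
    exact ⟨regular_zero _, fun i j h1 h2 => by simp at h2; omega, certified_zero X _⟩
  | succ n ih =>
    obtain ⟨hR, hS, hC⟩ := ih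
    rw [fsdmMatrix, hS.dual_eq]
    exact ⟨(regular_glue hR hR).recast _, (selfDual_glue hR hS).recast _,
      (certified_glue hR hC hC).recast _⟩

end HMat

theorem mainTheorem8 {X : Type*} [NormedAddCommGroup X] [InnerProductSpace ℝ X] [CompleteSpace X]
    (T : X → X) (hT : LipschitzWith 1 T) (y₀ yStar : X) (hfix : T yStar = yStar) :
    (∀ (n : ℕ) (H : Matrix (Fin n) (Fin n) ℝ) (N' : ℕ), 1 ≤ N' → N' ≤ n →
      HMat.IsVertex H → HMat.DecomposableAt H N' →
        ‖HMat.iter (HMat.ent H) T y₀ (N' - 1) - T (HMat.iter (HMat.ent H) T y₀ (N' - 1))‖ ^ 2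
          ≤ 4 * ‖y₀ - yStar‖ ^ 2 / (N' : ℝ) ^ 2) ∧
    (∀ (p : ℕ) (hp : 1 ≤ p) (k : ℕ),
        ‖HMat.iter (HMat.rdoSteps p hp) T y₀ (k * p)
            - T (HMat.iter (HMat.rdoSteps p hp) T y₀ (k * p))‖ ^ 2
          ≤ 4 * ‖y₀ - yStar‖ ^ 2 / ((k : ℝ) * p + 1) ^ 2) ∧
    (∀ n : ℕ,
        ‖HMat.iter HMat.fsdmSteps T y₀ (2 ^ n - 1)
            - T (HMat.iter HMat.fsdmSteps T y₀ (2 ^ n - 1))‖ ^ 2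
          ≤ 4 * ‖y₀ - yStar‖ ^ 2 / ((2 : ℝ) ^ n) ^ 2) := by
  refine ⟨fun n H N' h1 h2 hV hD => ?_, fun p hp k => ?_, fun n => ?_⟩
  · obtain ⟨a, rfl⟩ : ∃ a, N' = a + 1 := ⟨N' - 1, by omega⟩
    obtain ⟨hc, hAB⟩ := HMat.certMatrix_block hD
    obtain ⟨hrow, hoff⟩ := HMat.certMatrix_of_mem_optimalSet hV.1
    have := (HMat.certified_initial_block (X := X) hrow hoff hAB h2 hc).rate hT y₀ hfix
    rwa [Nat.add_sub_cancel, Nat.cast_add, Nat.cast_one]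
  · rw [HMat.iter_congr T y₀ (k * p) fun i j _ _ hi => HMat.rdoSteps_eq p hp k i j hi]
    have := (HMat.certified_rdoMatrix X p hp k).rate hT y₀ hfix
    rwa [Nat.cast_mul] at this
  · rw [HMat.iter_congr T y₀ (2 ^ n - 1) fun i j _ _ hi => HMat.fsdmSteps_eq n i j hi]
    have := (HMat.fsdmMatrix_spec X n).2.2.rate hT y₀ hfix
    have e : ((2 ^ n - 1 : ℕ) : ℝ) + 1 = 2 ^ n := by
      exact_mod_cast Nat.sub_add_cancel (Nat.one_le_two_pow (n := n))
    rwa [e] at this
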